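/- For an integer $\ell \geq 1$, let $\mathbb{O}_3(\ell,\mathbb{Q})$ denote the set of all $3\times 3$ rational orthogonal matrices $Q$ (that is, $Q\in\mathbb{Q}^{3\times 3}$ with $Q^{\mathsf T}Q = I$) whose level is $\ell$, where the level of a rational matrix $Q$ is the least integer $m\geq 1$ such that $mQ$ has integer entries. Then, for every integer $\ell\geq 1$, $\mathbb{O}_3(\ell,\mathbb{Q})\neq\emptyset$ if and only if $\ell$ is odd. Moreover, if $\ell$ is odd, then $\mathbb{O}_3(\ell,\mathbb{Q})$ is finite and $$\#\mathbb{O}_3(\ell,\mathbb{Q}) = 48\,\ell\prod_{p\mid \ell}\Bigl(1+\frac1p\Bigr),$$ where the product runs over the distinct prime divisors $p$ of $\ell$. -/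

import Mathlib

/-- `ℓ` is the level of the rational matrix `Q`: the least integer `ℓ ≥ 1` such that
all entries of `ℓ Q` are integers. -/
def IsLevel {n : ℕ} (Q : Matrix (Fin n) (Fin n) ℚ) (ℓ : ℕ) : Prop :=
  IsLeast {m : ℕ | 1 ≤ m ∧ ∃ G : Matrix (Fin n) (Fin n) ℤ, (m : ℚ) • Q = G.map (Int.cast : ℤ → ℚ)} ℓ

/-- The set of all rational orthogonal `n × n` matrices with level `ℓ`. -/
def rationalOrthogonalOfLevel (n ℓ : ℕ) : Set (Matrix (Fin n) (Fin n) ℚ) :=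
  {Q | Q ∈ Matrix.orthogonalGroup (Fin n) ℚ ∧ IsLevel Q ℓ}

/-! Scaling by `ℓ` turns the matrices to be counted into the integer matrices `G` with `Gᵀ * G = ℓ²
• 1` that no prime dividing `ℓ` divides (`primitiveSimilitudes`). Modulo 4 a sum of three squares
vanishes only if all three terms are even, so `ℓ` must be odd.

For odd `ℓ` the count is a double count of pairs `(G, v)`, where `G ≡ v wᵀ` mod `ℓ` and `v` is an
isotropic unimodular vector over `ZMod ℓ`.

Fix `G`. Its adjugate is divisible by `ℓ`, so its reduction has vanishing 2×2 minors and factors as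
`v wᵀ`; `v` is unique up to a unit, which gives `φ(ℓ)` choices.

Fix `v`. It determines an `ℓ`-neighbour of `ℤ³`, a unimodular lattice of rank three. Minkowski's
theorem yields an orthonormal basis, hence some `G` over `v`. Every other `G` over `v` has its
columns in the same lattice (`transpose_mem_neighbourLattice`), so it differs by one of the 48
signed permutation matrices.

It remains to count the vectors `v`. By the Chinese remainder theorem `ℓ` may be a prime power;
there the form becomes `xy - z²`, whose zeros are parametrized explicitly, and the total is `φ(ℓ) ℓ
∏ (1 + 1/p)`. The factor `φ(ℓ)` cancels. -/

open Matrix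

/-! ### Counting isotropic vectors modulo `ℓ` -/

/-- The isotropic unimodular vectors of the form `x² + y² + z²` over `R`. -/
def isotropicUnimodular (R : Type*) [CommRing R] : Set (Fin 3 → R) :=
  {v | v ⬝ᵥ v = 0 ∧ ∃ b : Fin 3 → R, b ⬝ᵥ v = 1}

theorem card_isotropicUnimodular_of_equiv_prod {R S T : Type*} [CommRing R] [CommRing S]
    [CommRing T] (e : R ≃+* S × T) :
    Nat.card (isotropicUnimodular R) =
      Nat.card (isotropicUnimodular S) * Nat.card (isotropicUnimodular T) := by
  rw [← Nat.card_prod]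
  have key : ∀ x y : Fin 3 → R, e (x ⬝ᵥ y) =
      ((fun i => (e (x i)).1) ⬝ᵥ (fun i => (e (y i)).1),
        (fun i => (e (x i)).2) ⬝ᵥ (fun i => (e (y i)).2)) := by
    intro x y
    simp [dotProduct, Fin.sum_univ_three, Prod.ext_iff]
  refine Nat.card_congr
    { toFun := fun v => (⟨fun i => (e (v.1 i)).1, ?_, ?_⟩, ⟨fun i => (e (v.1 i)).2, ?_, ?_⟩)
      invFun := fun v => ⟨fun i => e.symm (v.1.1 i, v.2.1 i), ?_, ?_⟩
      left_inv := ?_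
      right_inv := ?_ }
  · have h := key v.1 v.1
    rw [v.2.1, map_zero] at h
    exact (congrArg Prod.fst h).symm
  · obtain ⟨b, hb⟩ := v.2.2
    have h := key b v.1
    rw [hb, map_one] at h
    exact ⟨fun i => (e (b i)).1, (congrArg Prod.fst h).symm⟩
  · have h := key v.1 v.1
    rw [v.2.1, map_zero] at h
    exact (congrArg Prod.snd h).symm
  · obtain ⟨b, hb⟩ := v.2.2
    have h := key b v.1
    rw [hb, map_one] at h
    exact ⟨fun i => (e (b i)).2, (congrArg Prod.snd h).symm⟩
  · apply e.injective
    rw [key]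
    simpa [Prod.ext_iff] using ⟨v.1.2.1, v.2.2.1⟩
  · obtain ⟨b, hb⟩ := v.1.2.2
    obtain ⟨c, hc⟩ := v.2.2.2
    refine ⟨fun i => e.symm (b i, c i), ?_⟩
    apply e.injective
    rw [key]
    simpa [Prod.ext_iff] using ⟨hb, hc⟩
  · intro v
    ext i
    simp
  · intro v
    ext i <;> simp

/-- A solution of `a² + b² = -1` and an inverse of 2 change the form into `xy - z²`. On its zeros,
if `x` is a unit then `z` is free and `y = z²/x`; if not, `z` is a nonunit and unimodularity makes
`y` a unit, so `x = z²/y`. The two cases give the two summands. -/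
theorem card_isotropicUnimodular_of_isLocalRing {R : Type*} [CommRing R] [Finite R]
    [IsLocalRing R] {a b h : R} (hab : a ^ 2 + b ^ 2 = -1) (h2 : 2 * h = 1) :
    Nat.card (isotropicUnimodular R) =
      Nat.card Rˣ * (Nat.card R + Nat.card (nonunits R)) := by
  classical
  rw [mul_add, ← Nat.card_prod, ← Nat.card_prod, ← Nat.card_sum]
  symm
  -- Inverse of the substitution `x = v₀ - (a v₁ + b v₂)`, `y = v₀ + (a v₁ + b v₂)`, `z = b v₁ - a
  -- v₂`.
  let vec : R → R → R → Fin 3 → R := fun x y z =>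
    ![h * (x + y), -(a * (h * (y - x)) + b * z), a * z - b * (h * (y - x))]
  have hvec : ∀ x y z, vec x y z ⬝ᵥ vec x y z = x * y - z ^ 2 := by
    intro x y z
    simp only [vec, dotProduct, Fin.sum_univ_three, cons_val_zero, cons_val_one, cons_val]
    linear_combination (h ^ 2 * (y - x) ^ 2 + z ^ 2) * hab + x * y * (2 * h + 1) * h2
  have hx : ∀ x y z, vec x y z 0 - (a * vec x y z 1 + b * vec x y z 2) = x := by
    intro x y z
    simp only [vec, cons_val_zero, cons_val_one, cons_val]
    linear_combination (h * (y - x)) * hab + x * h2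
  have hy : ∀ x y z, vec x y z 0 + (a * vec x y z 1 + b * vec x y z 2) = y := by
    intro x y z
    simp only [vec, cons_val_zero, cons_val_one, cons_val]
    linear_combination (-h * (y - x)) * hab + y * h2
  have hz : ∀ x y z, b * vec x y z 1 - a * vec x y z 2 = z := by
    intro x y z
    simp only [vec, cons_val_zero, cons_val_one, cons_val]
    linear_combination (-z) * hab
  have hinv : ∀ v : Fin 3 → R, vec (v 0 - (a * v 1 + b * v 2)) (v 0 + (a * v 1 + b * v 2))
      (b * v 1 - a * v 2) = v := by
    intro v
    ext i
    fin_cases i <;> simp [vec]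
    · linear_combination v 0 * h2
    · linear_combination (-v 1) * hab - a * (a * v 1 + b * v 2) * h2
    · linear_combination (-v 2) * hab - b * (a * v 1 + b * v 2) * h2
  have hmem : ∀ x y z, x * y = z ^ 2 → IsUnit x ∨ IsUnit y →
      vec x y z ∈ isotropicUnimodular R := by
    intro x y z hxy hu
    refine ⟨by rw [hvec, hxy, sub_self], ?_⟩
    rcases hu with ⟨u, hu⟩ | ⟨u, hu⟩
    · refine ⟨![(↑u⁻¹ : R), -(↑u⁻¹ : R) * a, -(↑u⁻¹ : R) * b], ?_⟩
      have := hx x y z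
      simp only [dotProduct, Fin.sum_univ_three, cons_val_zero, cons_val_one, cons_val]
      have hu' : (↑u⁻¹ : R) * x = 1 := by rw [← hu]; simp
      linear_combination (↑u⁻¹ : R) * this + hu'
    · refine ⟨![(↑u⁻¹ : R), (↑u⁻¹ : R) * a, (↑u⁻¹ : R) * b], ?_⟩
      have := hy x y z
      simp only [dotProduct, Fin.sum_univ_three, cons_val_zero, cons_val_one, cons_val]
      have hu' : (↑u⁻¹ : R) * y = 1 := by rw [← hu]; simp
      linear_combination (↑u⁻¹ : R) * this + hu'
  have hinj : ∀ x y z x' y' z', vec x y z = vec x' y' z' → x = x' ∧ y = y' ∧ z = z' := by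
    intro x y z x' y' z' e
    refine ⟨?_, ?_, ?_⟩
    · rw [← hx x y z, e, hx]
    · rw [← hy x y z, e, hy]
    · rw [← hz x y z, e, hz]
  let F : (Rˣ × R) ⊕ (Rˣ × nonunits R) → isotropicUnimodular R :=
    Sum.elim
      (fun t => ⟨vec t.1 (↑t.1⁻¹ * t.2 ^ 2) t.2, hmem _ _ _ (by simp) (Or.inl t.1.isUnit)⟩)
      (fun t => ⟨vec (↑t.1⁻¹ * (t.2 : R) ^ 2) t.1 t.2,
        hmem _ _ _ (by rw [mul_right_comm]; simp) (Or.inr t.1.isUnit)⟩)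
  refine Nat.card_congr (Equiv.ofBijective F ⟨?_, ?_⟩)
  · rintro (⟨u, z⟩ | ⟨u, z, hzn⟩) (⟨u', z'⟩ | ⟨u', z', hzn'⟩) e <;>
      obtain ⟨e1, e2, e3⟩ := hinj _ _ _ _ _ _ (congrArg Subtype.val e) <;>
      dsimp only at e1 e2 e3
    · rw [Units.ext e1, e3]
    · exfalso
      have : IsUnit ((↑u'⁻¹ : R) * z' ^ 2) := e1 ▸ u.isUnit
      exact hzn' ((isUnit_pow_iff two_ne_zero).1 (isUnit_of_mul_isUnit_right this))
    · exfalso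
      have : IsUnit ((↑u⁻¹ : R) * z ^ 2) := e1 ▸ u'.isUnit
      exact hzn ((isUnit_pow_iff two_ne_zero).1 (isUnit_of_mul_isUnit_right this))
    · subst e3
      rw [Units.ext e2]
  · rintro ⟨v, hv, c, hc⟩
    have hrec := hinv v
    set x := v 0 - (a * v 1 + b * v 2) with hxd
    set y := v 0 + (a * v 1 + b * v 2) with hyd
    set z := b * v 1 - a * v 2 with hzd
    have hxyz : x * y = z ^ 2 := by
      have := hvec x y z
      rw [hrec, hv] at this
      exact (sub_eq_zero.1 this.symm)
    by_cases hux : IsUnit x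
    · obtain ⟨u, hu⟩ := hux
      refine ⟨Sum.inl (u, z), Subtype.ext ?_⟩
      change vec u (↑u⁻¹ * z ^ 2) z = v
      rw [← hxyz, ← hu, Units.inv_mul_cancel_left, hu, hrec]
    · have hzn : z ∈ nonunits R := by
        intro hzu
        exact hux (isUnit_of_mul_isUnit_left (hxyz ▸ hzu.pow 2))
      have huy : IsUnit y := by
        by_contra huy
        have hcomb : c 0 * (h * (x + y)) + c 1 * (-(a * (h * (y - x)) + b * z)) +
            c 2 * (a * z - b * (h * (y - x))) = 1 := by
          have hd : c ⬝ᵥ vec x y z = 1 := by rw [hrec, hc]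
          simpa [vec, dotProduct, Fin.sum_univ_three] using hd
        have hm : ∀ t, t ∈ nonunits R → t ∈ IsLocalRing.maximalIdeal R := fun t ht =>
          (IsLocalRing.mem_maximalIdeal t).2 ht
        have h1 : (1 : R) ∈ IsLocalRing.maximalIdeal R := by
          rw [← hcomb]
          have e : c 0 * (h * (x + y)) + c 1 * (-(a * (h * (y - x)) + b * z)) +
            c 2 * (a * z - b * (h * (y - x))) =
              (c 0 * h + c 1 * a * h + c 2 * b * h) * x +
              (c 0 * h - c 1 * a * h - c 2 * b * h) * y + (c 2 * a - c 1 * b) * z := by ring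
          rw [e]
          exact add_mem (add_mem (Ideal.mul_mem_left _ _ (hm _ hux))
            (Ideal.mul_mem_left _ _ (hm _ huy))) (Ideal.mul_mem_left _ _ (hm _ hzn))
        exact (IsLocalRing.mem_maximalIdeal 1).1 h1 isUnit_one
      obtain ⟨u, hu⟩ := huy
      refine ⟨Sum.inr (u, ⟨z, hzn⟩), Subtype.ext ?_⟩
      change vec (↑u⁻¹ * z ^ 2) u z = v
      rw [← hxyz, ← hu, mul_comm x, Units.inv_mul_cancel_left, hu, hrec]

/-- Hensel lifting in `a` with `b` fixed; the condition `p ∤ a` is carried along to keep the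
derivative `2a` invertible mod `p`. -/
theorem exists_prime_pow_dvd_sq_add_sq_add_one {p : ℕ} (hp : p.Prime) (hodd : Odd p) (k : ℕ) :
    ∃ a b : ℤ, ¬ (p : ℤ) ∣ a ∧ (p : ℤ) ^ (k + 1) ∣ a ^ 2 + b ^ 2 + 1 := by
  have hpz : Prime (p : ℤ) := Nat.prime_iff_prime_int.1 hp
  induction k with
  | zero =>
    have := Fact.mk hp
    obtain ⟨a, b, hab⟩ := ZMod.sq_add_sq p (-1)
    obtain ⟨a, rfl⟩ := ZMod.intCast_surjective a
    obtain ⟨b, rfl⟩ := ZMod.intCast_surjective b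
    have hd : (p : ℤ) ∣ a ^ 2 + b ^ 2 + 1 := by
      rw [← ZMod.intCast_zmod_eq_zero_iff_dvd]
      push_cast
      rw [hab]
      ring
    -- Not both of `a`, `b` are divisible by `p`, so swapping them if necessary makes the first one
    -- prime to `p`.
    by_cases ha : (p : ℤ) ∣ a
    · refine ⟨b, a, ?_, ?_⟩
      · intro hb
        apply hpz.not_dvd_one
        have : (p : ℤ) ∣ (a ^ 2 + b ^ 2 + 1) - a * a - b * b :=
          dvd_sub (dvd_sub hd (ha.mul_left a)) (hb.mul_left b)
        ring_nf at this
        exact this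
      · rw [zero_add, pow_one, add_comm (b ^ 2)]
        exact hd
    · exact ⟨a, b, ha, by simpa using hd⟩
  | succ k ih =>
    obtain ⟨a, b, ha, m, hm⟩ := ih
    have h2a : ¬ (p : ℤ) ∣ 2 * a := by
      intro h
      rcases hpz.dvd_or_dvd h with h | h
      · have : p ∣ 2 := by exact_mod_cast h
        have := (Nat.prime_dvd_prime_iff_eq hp Nat.prime_two).1 this
        subst this
        exact absurd hodd (by decide)
      · exact ha h
    obtain ⟨s, t, hst⟩ : IsCoprime (2 * a) (p : ℤ) :=
      ((Prime.coprime_iff_not_dvd hpz).2 h2a).symm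
    -- Newton step: `s` inverts `2a` mod `p`, and `m` is the quotient of `a² + b² + 1` by `p ^ (k +
    -- 1)`.
    refine ⟨a - p ^ (k + 1) * (s * m), b, ?_, ?_⟩
    · intro h
      apply ha
      have : (p : ℤ) ∣ (a - p ^ (k + 1) * (s * m)) + p * (p ^ k * (s * m)) :=
        dvd_add h (dvd_mul_right _ _)
      rw [pow_succ] at this
      ring_nf at this
      exact this
    · refine ⟨t * m + p ^ k * (s * m) ^ 2, ?_⟩
      linear_combination hm - (p : ℤ) ^ (k + 1) * m * hst

theorem card_isotropicUnimodular_prime_pow {p : ℕ} (hp : p.Prime) (hodd : Odd p) (k : ℕ) :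
    Nat.card (isotropicUnimodular (ZMod (p ^ (k + 1)))) =
      Nat.totient (p ^ (k + 1)) * (p ^ (k + 1) + p ^ k) := by
  have hpos : 0 < p ^ (k + 1) := pow_pos hp.pos _
  have : NeZero (p ^ (k + 1)) := ⟨hpos.ne'⟩
  have := Fact.mk hp
  have : Nontrivial (ZMod (p ^ (k + 1))) := by
    apply ZMod.nontrivial_iff.2
    exact (Nat.one_lt_pow (Nat.succ_ne_zero k) hp.one_lt).ne'
  have hunit : ∀ n : ℕ, (n : ZMod (p ^ (k + 1))) ∈ nonunits _ ↔ p ∣ n := by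
    intro n
    rw [mem_nonunits_iff, ZMod.isUnit_iff_coprime, Nat.coprime_pow_right_iff (Nat.succ_pos k),
      Nat.coprime_comm, hp.coprime_iff_not_dvd, not_not]
  have : IsLocalRing (ZMod (p ^ (k + 1))) := by
    refine IsLocalRing.of_nonunits_add fun x y hx hy => ?_
    rw [← ZMod.natCast_zmod_val x] at hx ⊢
    rw [← ZMod.natCast_zmod_val y] at hy ⊢
    rw [← Nat.cast_add, hunit]
    exact dvd_add ((hunit _).1 hx) ((hunit _).1 hy)
  obtain ⟨a, b, -, hab⟩ := exists_prime_pow_dvd_sq_add_sq_add_one hp hodd k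
  obtain ⟨m, hm⟩ := hodd.pow (n := k + 1)
  have hab' : (a : ZMod (p ^ (k + 1))) ^ 2 + (b : ZMod (p ^ (k + 1))) ^ 2 = -1 := by
    have h := (ZMod.intCast_zmod_eq_zero_iff_dvd (a ^ 2 + b ^ 2 + 1) (p ^ (k + 1))).2
      (by exact_mod_cast hab)
    push_cast at h
    linear_combination h
  -- The modulus is `2m + 1`, so `-m` is the inverse of 2.
  have h2 : 2 * (-(m : ZMod (p ^ (k + 1)))) = 1 := by
    have h := congrArg (Nat.cast : ℕ → ZMod (p ^ (k + 1))) hm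
    rw [ZMod.natCast_self] at h
    push_cast at h
    linear_combination h
  rw [card_isotropicUnimodular_of_isLocalRing hab' h2]
  have hu : Nat.card (ZMod (p ^ (k + 1)))ˣ = Nat.totient (p ^ (k + 1)) := by
    rw [Nat.card_eq_fintype_card, ZMod.card_units_eq_totient]
  have hR : Nat.card (ZMod (p ^ (k + 1))) = p ^ (k + 1) := by
    rw [Nat.card_eq_fintype_card, ZMod.card]
  have hn : Nat.card (nonunits (ZMod (p ^ (k + 1)))) = p ^ k := by
    have e1 : Nat.card (nonunits (ZMod (p ^ (k + 1)))) +
        Nat.card (ZMod (p ^ (k + 1)))ˣ = p ^ (k + 1) := by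
      have hc := Set.ncard_add_ncard_compl (nonunits (ZMod (p ^ (k + 1))))
      rw [hR, ← Nat.card_coe_set_eq, ← Nat.card_coe_set_eq] at hc
      refine Eq.trans ?_ hc
      congr 1
      exact Nat.card_congr <| Equiv.ofBijective
        (fun u => ⟨u, fun h => h u.isUnit⟩)
        ⟨fun u v h => Units.ext (congrArg Subtype.val h),
          fun x => ⟨(not_not.1 x.2).unit, rfl⟩⟩
    rw [hu, Nat.totient_prime_pow_succ hp] at e1
    have : p ^ k * (p - 1) + p ^ k = p ^ (k + 1) := by
      rw [← Nat.mul_succ, Nat.succ_eq_add_one, Nat.sub_add_cancel hp.one_lt.le, pow_succ]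
    omega
  rw [hu, hR, hn]

theorem card_isotropicUnimodular_zmod (n : ℕ) (hn : Odd n) :
    (Nat.card (isotropicUnimodular (ZMod n)) : ℚ) =
      Nat.totient n * (n * ∏ p ∈ n.primeFactors, (1 + 1 / (p : ℚ))) := by
  induction n using Nat.recOnPosPrimePosCoprime with
  | prime_pow p k hp hk =>
    obtain ⟨k, rfl⟩ := Nat.exists_eq_succ_of_ne_zero hk.ne'
    rw [Nat.succ_eq_add_one] at *
    have hpo : Odd p := by
      rcases Nat.even_or_odd p with h | h
      · exact absurd hn (Nat.not_odd_iff_even.2 (h.pow_of_ne_zero k.succ_ne_zero))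
      · exact h
    have hp0 : (p : ℚ) ≠ 0 := by exact_mod_cast hp.ne_zero
    rw [card_isotropicUnimodular_prime_pow hp hpo, Nat.primeFactors_prime_pow k.succ_ne_zero hp,
      Finset.prod_singleton]
    push_cast
    field_simp
    ring
  | zero => exact absurd hn (by decide)
  | one =>
    -- In the zero ring `0 = 1`, so the zero vector counts as unimodular.
    have : Nat.card (isotropicUnimodular (ZMod 1)) = 1 := by
      rw [Nat.card_eq_one_iff_unique]
      exact ⟨inferInstance, ⟨⟨0, Subsingleton.elim _ _, 0, Subsingleton.elim _ _⟩⟩⟩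
    simp [this]
  | coprime a b ha hb hab iha ihb =>
    rw [Nat.odd_mul] at hn
    rw [card_isotropicUnimodular_of_equiv_prod (ZMod.chineseRemainder hab), Nat.cast_mul,
      iha hn.1, ihb hn.2, Nat.totient_mul hab, hab.primeFactors_mul,
      Finset.prod_union hab.disjoint_primeFactors]
    push_cast
    ring

/-! ### Short vectors by Minkowski's theorem -/

theorem volume_dotProduct_self_lt_one :
    MeasureTheory.volume {y : Fin 3 → ℝ | y ⬝ᵥ y < 1} = ENNReal.ofReal (Real.pi * 4 / 3) := by
  have h : {y : Fin 3 → ℝ | y ⬝ᵥ y < 1} =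
      (MeasurableEquiv.toLp 2 (Fin 3 → ℝ)) ⁻¹' Metric.ball (0 : EuclideanSpace ℝ (Fin 3)) 1 := by
    ext y
    simp [EuclideanSpace.norm_eq, dotProduct, Fin.sum_univ_three, Real.sqrt_lt', pow_two]
  rw [h, (PiLp.volume_preserving_toLp (Fin 3)).measure_preimage_equiv]
  simp

theorem convex_dotProduct_self_lt_one : Convex ℝ {y : Fin 3 → ℝ | y ⬝ᵥ y < 1} := by
  have h : {y : Fin 3 → ℝ | y ⬝ᵥ y < 1} =
      ((WithLp.linearEquiv 2 ℝ (Fin 3 → ℝ)).symm : (Fin 3 → ℝ) →ₗ[ℝ] EuclideanSpace ℝ (Fin 3)) ⁻¹'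
        Metric.ball (0 : EuclideanSpace ℝ (Fin 3)) 1 := by
    ext y
    simp [EuclideanSpace.norm_eq, dotProduct, Fin.sum_univ_three, Real.sqrt_lt', pow_two]
  rw [h]
  exact (convex_ball _ _).linear_preimage _

/-- Minkowski's convex body theorem for an ellipsoid in dimension three. -/
theorem exists_int_vec_dotProduct_self_lt_one (C : Matrix (Fin 3) (Fin 3) ℝ) (h0 : C.det ≠ 0)
    (h : |C.det| ≤ 1 / 2) :
    ∃ z : Fin 3 → ℤ, z ≠ 0 ∧
      (C *ᵥ fun i => (z i : ℝ)) ⬝ᵥ (C *ᵥ fun i => (z i : ℝ)) < 1 := by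
  have hdet : LinearMap.det (toLin' C) ≠ 0 := by rwa [LinearMap.det_toLin']
  have hvol : MeasureTheory.volume (ZSpan.fundamentalDomain (Pi.basisFun ℝ (Fin 3))) *
      2 ^ Module.finrank ℝ (Fin 3 → ℝ) <
      MeasureTheory.volume ((toLin' C) ⁻¹' {y : Fin 3 → ℝ | y ⬝ᵥ y < 1}) := by
    rw [MeasureTheory.Measure.addHaar_preimage_linearMap _ hdet, volume_dotProduct_self_lt_one,
      ZSpan.volume_fundamentalDomain, LinearMap.det_toLin', Module.finrank_fin_fun, abs_inv,
      ← ENNReal.ofReal_mul (by positivity)]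
    have e : (Matrix.of ⇑(Pi.basisFun ℝ (Fin 3))).det = 1 := by
      rw [show Matrix.of ⇑(Pi.basisFun ℝ (Fin 3)) = 1 from ?_, det_one]
      ext i j
      simp [Matrix.one_apply, Pi.single_apply, eq_comm]
    rw [e, abs_one, ENNReal.ofReal_one, one_mul,
      show (2 : ENNReal) ^ 3 = ENNReal.ofReal 8 by norm_num]
    apply (ENNReal.ofReal_lt_ofReal_iff (by positivity)).2
    have hp : 0 < |C.det| := abs_pos.2 h0
    -- The ellipsoid has volume `(4π/3) / |det C| ≥ 8π/3`, which exceeds `2³` because `π > 3`.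
    have h2 : 2 ≤ |C.det|⁻¹ := by
      rw [le_inv_comm₀ two_pos hp]
      linarith
    have := Real.pi_gt_three
    nlinarith
  have : Countable (Submodule.span ℤ (Set.range (Pi.basisFun ℝ (Fin 3)))).toAddSubgroup :=
    inferInstanceAs (Countable (Submodule.span ℤ (Set.range (Pi.basisFun ℝ (Fin 3)))))
  obtain ⟨⟨x, hx⟩, hne, hxs⟩ :=
    MeasureTheory.exists_ne_zero_mem_lattice_of_measure_mul_two_pow_lt_measure
      (ZSpan.isAddFundamentalDomain' (Pi.basisFun ℝ (Fin 3)) MeasureTheory.volume)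
      (by intro x hx; simpa [mulVec_neg] using hx)
      (convex_dotProduct_self_lt_one.linear_preimage _) hvol
  have hx' := (Module.Basis.mem_span_iff_repr_mem ℤ (Pi.basisFun ℝ (Fin 3)) x).1 hx
  choose z hz using hx'
  have hzx : (fun i => (z i : ℝ)) = x := by
    ext i
    simpa using hz i
  refine ⟨z, ?_, ?_⟩
  · rintro rfl
    apply hne
    ext i
    simp [← hzx]
  · rw [hzx]
    simpa using hxs

/-- A full-rank integral lattice `B ℤ³` of determinant `ℓ³` all of whose inner products
are divisible by `ℓ²`, contains two orthogonal vectors of norm `ℓ²`. -/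
theorem exists_orthogonal_pair (B : Matrix (Fin 3) (Fin 3) ℤ) {l : ℕ} (hl : 1 ≤ l)
    (hdet : B.det ^ 2 = (l : ℤ) ^ 6)
    (hint : ∀ z w : Fin 3 → ℤ, (l : ℤ) ^ 2 ∣ (B *ᵥ z) ⬝ᵥ (B *ᵥ w)) :
    ∃ z w : Fin 3 → ℤ, (B *ᵥ z) ⬝ᵥ (B *ᵥ z) = (l : ℤ) ^ 2 ∧
      (B *ᵥ w) ⬝ᵥ (B *ᵥ w) = (l : ℤ) ^ 2 ∧ (B *ᵥ z) ⬝ᵥ (B *ᵥ w) = 0 := by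
  have hlz : (0 : ℤ) < l := by exact_mod_cast hl
  have hlr : (0 : ℝ) < l := by exact_mod_cast hl
  have hB0 : B.det ≠ 0 := by
    intro h
    rw [h] at hdet
    have : (0 : ℤ) < (l : ℤ) ^ 6 := by positivity
    rw [← hdet] at this
    norm_num at this
  let B' : Matrix (Fin 3) (Fin 3) ℝ := (l : ℝ)⁻¹ • B.map (Int.cast : ℤ → ℝ)
  have hB' : |B'.det| = 1 := by
    have h1 : B'.det = ((l : ℝ)⁻¹) ^ 3 * (B.det : ℝ) := by
      simp only [B', det_smul, Fintype.card_fin]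
      congr 1
      exact (Int.cast_det B).symm
    have h2 : (B.det : ℝ) ^ 2 = (l : ℝ) ^ 6 := by exact_mod_cast hdet
    rw [← sq_eq_sq₀ (abs_nonneg _) zero_le_one, sq_abs, h1, mul_pow, h2]
    field_simp
  have hmul : ∀ z : Fin 3 → ℤ, (B' *ᵥ fun i => (z i : ℝ)) =
      fun i => (l : ℝ)⁻¹ * ((B *ᵥ z) i : ℝ) := by
    intro z
    ext i
    simp [B', mulVec, dotProduct, Fin.sum_univ_three]
    ring
  have hne : ∀ z : Fin 3 → ℤ, z ≠ 0 → 0 < (B *ᵥ z) ⬝ᵥ (B *ᵥ z) := by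
    intro z hz
    have h1 : 0 ≤ (B *ᵥ z) ⬝ᵥ (B *ᵥ z) :=
      Finset.sum_nonneg fun i _ => mul_self_nonneg _
    refine lt_of_le_of_ne h1 fun h => hz ?_
    exact eq_zero_of_mulVec_eq_zero hB0 (dotProduct_self_eq_zero.1 h.symm)
  -- Norms are multiples of `ℓ²`, so a nonzero vector of norm below `2ℓ²` has norm exactly `ℓ²`.
  have hnorm : ∀ z : Fin 3 → ℤ, z ≠ 0 → (B *ᵥ z) ⬝ᵥ (B *ᵥ z) < 2 * (l : ℤ) ^ 2 →
      (B *ᵥ z) ⬝ᵥ (B *ᵥ z) = (l : ℤ) ^ 2 := by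
    intro z hz hlt
    have hpos := hne z hz
    obtain ⟨k, hk⟩ := hint z z
    rw [hk] at hlt hpos ⊢
    have h3 : 0 < (l : ℤ) ^ 2 := by positivity
    have h4 : 0 < k := (pos_iff_pos_of_mul_pos hpos).1 h3
    have h5 : k < 2 := by nlinarith
    have : k = 1 := by omega
    rw [this, mul_one]
  -- The ball of radius `√2` in the lattice rescaled to covolume 1; the determinant `2^(-3/2)` is at
  -- most `1/2`.
  obtain ⟨z, hz0, hz⟩ := exists_int_vec_dotProduct_self_lt_one ((√2)⁻¹ • B') (by
      rw [det_smul]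
      apply mul_ne_zero (by positivity)
      intro h; rw [h] at hB'; norm_num at hB') (by
      rw [det_smul, abs_mul, hB', mul_one, abs_of_pos (by positivity), Fintype.card_fin, inv_pow,
        one_div]
      apply inv_anti₀ two_pos
      have h2 : (√2) ^ 2 = 2 := Real.sq_sqrt two_pos.le
      have h1 : 1 ≤ √2 := Real.one_le_sqrt.2 one_le_two
      nlinarith)
  have hzn : (B *ᵥ z) ⬝ᵥ (B *ᵥ z) = (l : ℤ) ^ 2 := by
    refine hnorm z hz0 ?_
    rw [smul_mulVec, hmul] at hz
    have h2 : (√2) ^ 2 = 2 := Real.sq_sqrt two_pos.le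
    have e : ((√2)⁻¹ • fun i => (l : ℝ)⁻¹ * ((B *ᵥ z) i : ℝ)) ⬝ᵥ
        ((√2)⁻¹ • fun i => (l : ℝ)⁻¹ * ((B *ᵥ z) i : ℝ)) =
        ((√2) ^ 2 * (l : ℝ) ^ 2)⁻¹ * (((B *ᵥ z) ⬝ᵥ (B *ᵥ z) : ℤ) : ℝ) := by
      simp only [dotProduct, Fin.sum_univ_three, Pi.smul_apply, smul_eq_mul]
      push_cast
      field_simp
    rw [e, h2, inv_mul_lt_one₀ (by positivity)] at hz
    exact_mod_cast hz
  set y := B *ᵥ z with hy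
  -- the ellipsoid `(x ⬝ x + (e ⬝ x)²) / 2 < 1` with `e = y / ℓ`
  let α : ℝ := (√2)⁻¹
  have hα : α ^ 2 = 1 / 2 := by
    simp only [α, inv_pow, Real.sq_sqrt two_pos.le, one_div]
  let e : Fin 3 → ℝ := fun i => (l : ℝ)⁻¹ * (y i : ℝ)
  have he : e ⬝ᵥ e = 1 := by
    have h1 : ((y ⬝ᵥ y : ℤ) : ℝ) = (l : ℝ) ^ 2 := by exact_mod_cast hzn
    simp only [e, dotProduct, Fin.sum_univ_three] at h1 ⊢
    push_cast at h1
    field_simp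
    linear_combination h1
  -- `M` fixes `e` and scales its orthogonal complement by `α`, so its determinant `α² = 1/2` just
  -- meets the Minkowski bound. The stretched form penalizes the direction `e` and so excludes `±e`
  -- themselves.
  let M : Matrix (Fin 3) (Fin 3) ℝ := α • 1 + (1 - α) • vecMulVec e e
  have hM : M.det = 1 / 2 := by
    have h1 : M.det = α ^ 2 * (α + (1 - α) * (e ⬝ᵥ e)) := by
      simp [M, det_fin_three, vecMulVec_apply, dotProduct, Fin.sum_univ_three]
      ring
    rw [h1, he, hα]
    ring
  obtain ⟨w, hw0, hw⟩ := exists_int_vec_dotProduct_self_lt_one (M * B') (by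
      rw [det_mul, hM]
      apply mul_ne_zero (by norm_num)
      intro h; rw [h] at hB'; norm_num at hB') (by
      rw [det_mul, hM, abs_mul, hB', mul_one]
      exact (abs_of_pos one_half_pos).le)
  have hquad : ∀ x : Fin 3 → ℝ, (M *ᵥ x) ⬝ᵥ (M *ᵥ x) = (x ⬝ᵥ x + (e ⬝ᵥ x) ^ 2) / 2 := by
    intro x
    have h1 : M *ᵥ x = α • x + ((1 - α) * (e ⬝ᵥ x)) • e := by
      ext i
      fin_cases i <;>
        simp [M, mulVec, dotProduct, Fin.sum_univ_three, vecMulVec_apply, Matrix.one_apply] <;> ring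
    rw [h1]
    simp only [add_dotProduct, dotProduct_add, smul_dotProduct, dotProduct_smul, smul_eq_mul, he,
      dotProduct_comm x e]
    linear_combination (x ⬝ᵥ x - (e ⬝ᵥ x) ^ 2) * hα
  rw [← mulVec_mulVec, hquad, hmul] at hw
  set y' := B *ᵥ w with hy'
  set m : ℤ := y ⬝ᵥ y' with hm
  have e1 : (fun i => (l : ℝ)⁻¹ * (y' i : ℝ)) ⬝ᵥ (fun i => (l : ℝ)⁻¹ * (y' i : ℝ)) =
      ((y' ⬝ᵥ y' : ℤ) : ℝ) / (l : ℝ) ^ 2 := by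
    simp only [dotProduct, Fin.sum_univ_three]
    push_cast
    field_simp
  have e2 : e ⬝ᵥ (fun i => (l : ℝ)⁻¹ * (y' i : ℝ)) = (m : ℝ) / (l : ℝ) ^ 2 := by
    simp only [hm, e, dotProduct, Fin.sum_univ_three]
    push_cast
    field_simp
  rw [e1, e2] at hw
  have hcs : m ^ 2 ≤ (l : ℤ) ^ 2 * (y' ⬝ᵥ y') := by
    rw [← hzn, hm]
    simp only [dotProduct, Fin.sum_univ_three]
    nlinarith [sq_nonneg (y 0 * y' 1 - y 1 * y' 0), sq_nonneg (y 0 * y' 2 - y 2 * y' 0),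
      sq_nonneg (y 1 * y' 2 - y 2 * y' 1)]
  have hw' : (l : ℤ) ^ 2 * (y' ⬝ᵥ y') + m ^ 2 < 2 * (l : ℤ) ^ 4 := by
    have : (l : ℝ) ^ 2 * ((y' ⬝ᵥ y' : ℤ) : ℝ) + (m : ℝ) ^ 2 < 2 * (l : ℝ) ^ 4 := by
      have h4 : (0 : ℝ) < 2 * (l : ℝ) ^ 4 := by positivity
      have h5 := mul_lt_mul_of_pos_left hw h4
      rw [mul_one] at h5
      refine lt_of_eq_of_lt ?_ h5
      have hl0 : (l : ℝ) ≠ 0 := hlr.ne'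
      generalize ((y' ⬝ᵥ y' : ℤ) : ℝ) = s
      field_simp
    exact_mod_cast this
  -- Cauchy–Schwarz and `hw'` give `m² < ℓ⁴`, while `ℓ²` divides `m`.
  have hm0 : m = 0 := by
    obtain ⟨k, hk⟩ : (l : ℤ) ^ 2 ∣ m := hint z w
    have h6 : (l : ℤ) ^ 4 * k ^ 2 < (l : ℤ) ^ 4 * 1 := by
      have : m ^ 2 = (l : ℤ) ^ 4 * k ^ 2 := by rw [hk]; ring
      linarith
    have h7 : k ^ 2 < 1 := lt_of_mul_lt_mul_left h6 (by positivity)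
    have : k = 0 := by nlinarith
    rw [hk, this, mul_zero]
  refine ⟨z, w, hzn, hnorm w hw0 ?_, hm0⟩
  rw [hm0] at hw'
  have h8 : (l : ℤ) ^ 2 * (y' ⬝ᵥ y') < (l : ℤ) ^ 2 * (2 * (l : ℤ) ^ 2) := by
    linarith
  exact lt_of_mul_lt_mul_left h8 (by positivity)

/-! ### The neighbour lattice of an isotropic vector -/

theorem exists_int_lift_isotropic {l : ℕ} (hodd : Odd l) {v : Fin 3 → ZMod l}
    (hv : v ∈ isotropicUnimodular (ZMod l)) :
    ∃ u b : Fin 3 → ℤ, (∀ i, (u i : ZMod l) = v i) ∧ (l : ℤ) ^ 2 ∣ u ⬝ᵥ u ∧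
      (l : ℤ) ∣ b ⬝ᵥ u - 1 := by
  obtain ⟨hv0, b', hb'⟩ := hv
  choose u hu using fun i => ZMod.intCast_surjective (v i)
  choose b hb using fun i => ZMod.intCast_surjective (b' i)
  have h1 : (l : ℤ) ∣ u ⬝ᵥ u := by
    rw [← ZMod.intCast_zmod_eq_zero_iff_dvd, ← hv0]
    simp [dotProduct, hu]
  have h2 : (l : ℤ) ∣ b ⬝ᵥ u - 1 := by
    rw [← ZMod.intCast_zmod_eq_zero_iff_dvd, Int.cast_sub, Int.cast_one, sub_eq_zero, ← hb']
    simp [dotProduct, hu, hb]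
  obtain ⟨s, hs⟩ := h1
  obtain ⟨r, hr⟩ := h2
  obtain ⟨m, hm⟩ := hodd
  have hm' : (l : ℤ) = 2 * m + 1 := by exact_mod_cast hm
  -- With `u ⬝ᵥ u = ℓ s` and `b ⬝ᵥ u ≡ 1`, the correction changes the norm by `2mℓs` mod `ℓ²`; as
  -- `2m + 1 = ℓ`, the sum `ℓs(1 + 2m)` is divisible by `ℓ²`.
  refine ⟨u + (l * (m * s) : ℤ) • b, b, ?_, ?_, ?_⟩
  · intro i
    simp [hu]
  · refine ⟨s + 2 * m * s * r + (m * s) ^ 2 * (b ⬝ᵥ b), ?_⟩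
    simp only [add_dotProduct, dotProduct_add, smul_dotProduct, dotProduct_smul, smul_eq_mul,
      dotProduct_comm u b]
    linear_combination hs + 2 * l * (m * s) * hr - l * s * hm'
  · refine ⟨r + m * s * (b ⬝ᵥ b), ?_⟩
    simp only [dotProduct_add, dotProduct_smul, smul_eq_mul]
    linear_combination hr

/-- `ℓ` times the `ℓ`-neighbour of `ℤ³` attached to a vector `v` with `ℓ² ∣ v ⬝ v`. -/
def neighbourLattice (l : ℕ) (v : Fin 3 → ℤ) : Submodule ℤ (Fin 3 → ℤ) where
  carrier := {y | (∃ c : ℤ, ∀ i, (l : ℤ) ∣ y i - c * v i) ∧ (l : ℤ) ^ 2 ∣ y ⬝ᵥ v}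
  zero_mem' := ⟨⟨0, by simp⟩, by simp⟩
  add_mem' := by
    rintro x y ⟨⟨c, hc⟩, hx⟩ ⟨⟨d, hd⟩, hy⟩
    refine ⟨⟨c + d, fun i => ?_⟩, ?_⟩
    · have := dvd_add (hc i) (hd i)
      rwa [show x i - c * v i + (y i - d * v i) = (x + y) i - (c + d) * v i by
        simp only [Pi.add_apply]; ring] at this
    · rw [add_dotProduct]
      exact dvd_add hx hy
  smul_mem' := by
    rintro a y ⟨⟨d, hd⟩, hy⟩
    refine ⟨⟨a * d, fun i => ?_⟩, ?_⟩
    · have := (hd i).mul_left a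
      rwa [show a * (y i - d * v i) = (a • y) i - (a * d) * v i by
        simp only [Pi.smul_apply, smul_eq_mul]; ring] at this
    · rw [smul_dotProduct]
      exact hy.mul_left a

theorem sq_dvd_dotProduct_of_mem_neighbourLattice {l : ℕ} {v : Fin 3 → ℤ}
    (hv : (l : ℤ) ^ 2 ∣ v ⬝ᵥ v) {x y : Fin 3 → ℤ} (hx : x ∈ neighbourLattice l v)
    (hy : y ∈ neighbourLattice l v) : (l : ℤ) ^ 2 ∣ x ⬝ᵥ y := by
  obtain ⟨⟨c, hc⟩, hxv⟩ := hx
  obtain ⟨⟨d, hd⟩, hyv⟩ := hy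
  choose s hs using hc
  choose t ht using hd
  have h : x ⬝ᵥ y = d * (x ⬝ᵥ v) + c * (y ⬝ᵥ v) - c * d * (v ⬝ᵥ v) +
      (l : ℤ) ^ 2 * (s ⬝ᵥ t) := by
    have e : ∀ i, x i * y i = d * (x i * v i) + c * (y i * v i) - c * d * (v i * v i) +
        (l : ℤ) ^ 2 * (s i * t i) := by
      intro i
      linear_combination (y i - d * v i) * hs i + l * s i * ht i
    simp only [dotProduct, Fin.sum_univ_three, e]
    ring
  rw [h]
  exact dvd_add (dvd_sub (dvd_add (hxv.mul_left _) (hyv.mul_left _)) (hv.mul_left _))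
    (dvd_mul_right _ _)

theorem sq_smul_mem_neighbourLattice (l : ℕ) (v z : Fin 3 → ℤ) :
    ((l : ℤ) ^ 2) • z ∈ neighbourLattice l v := by
  refine ⟨⟨0, fun i => ?_⟩, ?_⟩
  · simp only [zero_mul, sub_zero, Pi.smul_apply, smul_eq_mul, pow_two, mul_assoc]
    exact dvd_mul_right _ _
  · rw [smul_dotProduct]
    exact dvd_mul_right _ _

/-- The neighbour lattice, scaled by `1 / ℓ`, is self-dual. -/
theorem exists_mem_neighbourLattice_of_dual {l : ℕ} (hl : 1 ≤ l) {v b : Fin 3 → ℤ}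
    (hv : (l : ℤ) ^ 2 ∣ v ⬝ᵥ v) (hb : (l : ℤ) ∣ b ⬝ᵥ v - 1) {m : ℤ} (hm : m ≠ 0)
    {d : Fin 3 → ℤ} (hd : ∀ y ∈ neighbourLattice l v, m * (l : ℤ) ^ 2 ∣ d ⬝ᵥ y) :
    ∃ y ∈ neighbourLattice l v, d = m • y := by
  have hl0 : (l : ℤ) ≠ 0 := by exact_mod_cast Nat.one_le_iff_ne_zero.1 hl
  have h1 : ∀ i, m ∣ d i := by
    intro i
    have := hd _ (sq_smul_mem_neighbourLattice l v (Pi.single i 1))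
    rw [dotProduct_smul, dotProduct_single, mul_one, smul_eq_mul, mul_comm m] at this
    exact (mul_dvd_mul_iff_left (pow_ne_zero 2 hl0)).1 this
  choose x hx using h1
  have hdx : d = m • x := funext hx
  have hxd : ∀ y ∈ neighbourLattice l v, (l : ℤ) ^ 2 ∣ x ⬝ᵥ y := by
    intro y hy
    have := hd y hy
    rw [hdx, smul_dotProduct, smul_eq_mul] at this
    exact (mul_dvd_mul_iff_left hm).1 this
  refine ⟨x, ⟨⟨b ⬝ᵥ x, fun i => ?_⟩, ?_⟩, hdx⟩
  -- Pairing `x` with this test vector gives `x i ≡ (b ⬝ᵥ x) v i` mod `ℓ`; pairing with `v` itself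
  -- gives the other membership condition.
  · have hmem : (l : ℤ) • (Pi.single i 1 - v i • b) ∈ neighbourLattice l v := by
      refine ⟨⟨0, fun j => ?_⟩, ?_⟩
      · rw [zero_mul, sub_zero, Pi.smul_apply]
        exact dvd_mul_right _ _
      · rw [smul_dotProduct, sub_dotProduct, smul_dotProduct, single_dotProduct, one_mul,
          smul_eq_mul, smul_eq_mul, pow_two]
        refine mul_dvd_mul_left _ ?_
        have := (hb.mul_left (v i)).neg_right
        rwa [show -(v i * (b ⬝ᵥ v - 1)) = v i - v i * b ⬝ᵥ v by ring] at this
    have := hxd _ hmem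
    rw [dotProduct_smul, dotProduct_sub, dotProduct_smul, dotProduct_single, mul_one,
      smul_eq_mul, smul_eq_mul, pow_two, mul_dvd_mul_iff_left hl0, dotProduct_comm x b,
      mul_comm (v i)] at this
    exact this
  · exact hxd v ⟨⟨1, fun i => by simp⟩, hv⟩

theorem exists_basisMatrix_neighbourLattice {l : ℕ} (hl : 1 ≤ l) (v : Fin 3 → ℤ) :
    ∃ B : Matrix (Fin 3) (Fin 3) ℤ, B.det ≠ 0 ∧
      ∀ y, y ∈ neighbourLattice l v ↔ ∃ z, B *ᵥ z = y := by
  have hl0 : (l : ℤ) ≠ 0 := by exact_mod_cast Nat.one_le_iff_ne_zero.1 hl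
  -- Multiplication by `ℓ²` embeds `ℤ³` in the lattice, which forces rank three.
  let f : (Fin 3 → ℤ) →ₗ[ℤ] neighbourLattice l v :=
    (((l : ℤ) ^ 2) • LinearMap.id).codRestrict _ (sq_smul_mem_neighbourLattice l v)
  have hf : Function.Injective f := by
    intro x y h
    have h' : ((l : ℤ) ^ 2) • x = ((l : ℤ) ^ 2) • y := congrArg Subtype.val h
    exact smul_right_injective _ (pow_ne_zero 2 hl0) h'
  have hrank : Module.finrank ℤ (neighbourLattice l v) = 3 := by
    apply le_antisymm
    · simpa using Submodule.finrank_le (neighbourLattice l v)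
    · simpa using LinearMap.finrank_le_finrank_of_injective hf
  let β := Module.finBasisOfFinrankEq ℤ (neighbourLattice l v) hrank
  let B : Matrix (Fin 3) (Fin 3) ℤ := fun i j => (β j : Fin 3 → ℤ) i
  have hB : ∀ z, B *ᵥ z = ((∑ j, z j • β j : neighbourLattice l v) : Fin 3 → ℤ) := by
    intro z
    ext i
    simp [B, mulVec, dotProduct, Fin.sum_univ_three, mul_comm]
  refine ⟨B, ?_, fun y => ⟨fun hy => ⟨β.repr ⟨y, hy⟩, ?_⟩, ?_⟩⟩
  · intro hdet
    obtain ⟨z, hz0, hz⟩ := exists_mulVec_eq_zero_iff.2 hdet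
    rw [hB] at hz
    have := Fintype.linearIndependent_iff.1 β.linearIndependent z (Subtype.ext hz)
    exact hz0 (funext this)
  · rw [hB, β.sum_repr]
  · rintro ⟨z, rfl⟩
    rw [hB]
    exact Subtype.prop _

/-- The Gram matrix is `ℓ² A` with `A` integral, and self-duality provides an integral inverse of
`A`. Hence `det A = ±1`, and positivity of `B.det ^ 2` fixes the sign. -/
theorem det_sq_of_basisMatrix_neighbourLattice {l : ℕ} (hl : 1 ≤ l) {v b : Fin 3 → ℤ}
    (hv : (l : ℤ) ^ 2 ∣ v ⬝ᵥ v) (hb : (l : ℤ) ∣ b ⬝ᵥ v - 1) {B : Matrix (Fin 3) (Fin 3) ℤ}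
    (hdet : B.det ≠ 0) (hB : ∀ y, y ∈ neighbourLattice l v ↔ ∃ z, B *ᵥ z = y) :
    B.det ^ 2 = (l : ℤ) ^ 6 := by
  have hl0 : (0 : ℤ) < l := by exact_mod_cast hl
  -- The rows of `ℓ² B⁻¹` form the dual basis for the scaled pairing; the factor `B.det` clears
  -- denominators.
  have hdual : ∀ j, ∃ z, ((l : ℤ) ^ 2) • B.adjugate j = B.det • (B *ᵥ z) := by
    intro j
    obtain ⟨y, hy, he⟩ := exists_mem_neighbourLattice_of_dual hl hv hb hdet
      (d := ((l : ℤ) ^ 2) • B.adjugate j) (by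
        intro y hy
        obtain ⟨z, rfl⟩ := (hB y).1 hy
        refine ⟨z j, ?_⟩
        have : B.adjugate j ⬝ᵥ (B *ᵥ z) = B.det * z j := by
          change (B.adjugate *ᵥ (B *ᵥ z)) j = _
          rw [mulVec_mulVec, adjugate_mul, smul_mulVec, one_mulVec]
          rfl
        rw [smul_dotProduct, this, smul_eq_mul]
        ring)
    obtain ⟨z, rfl⟩ := (hB y).1 hy
    exact ⟨z, he⟩
  choose N hN using hdual
  have hint : ∀ i j, (l : ℤ) ^ 2 ∣ (Bᵀ * B) i j := by
    intro i j
    have hcol : ∀ k, Bᵀ k ∈ neighbourLattice l v := fun k =>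
      (hB _).2 ⟨Pi.single k 1, by ext i; simp⟩
    exact sq_dvd_dotProduct_of_mem_neighbourLattice hv (hcol i) (hcol j)
  choose A hA using hint
  have hBA : Bᵀ * B = ((l : ℤ) ^ 2) • (Matrix.of A) := by
    ext i j
    exact hA i j
  have hNB : ((l : ℤ) ^ 2) • B.adjugate = B.det • (Matrix.of N * Bᵀ) := by
    ext i j
    have := congrFun (hN i) j
    simp only [Pi.smul_apply, smul_eq_mul, Matrix.smul_apply] at this ⊢
    rw [this]
    simp [mulVec, dotProduct, Matrix.mul_apply, mul_comm]
  have hNA : Matrix.of N * Matrix.of A = 1 := by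
    have h1 := congrArg (· * B) hNB
    simp only [smul_mul, adjugate_mul, Matrix.mul_assoc, hBA, Matrix.mul_smul] at h1
    ext i j
    have h2 := congrFun (congrFun h1 i) j
    simp only [Matrix.smul_apply, smul_eq_mul] at h2
    have h3 : B.det * (l : ℤ) ^ 2 ≠ 0 := mul_ne_zero hdet (by positivity)
    apply mul_left_cancel₀ h3
    linear_combination -h2
  have hd1 : (Matrix.of N).det * (Matrix.of A).det = 1 := by
    rw [← det_mul, hNA, det_one]
  have hd2 : B.det ^ 2 = (l : ℤ) ^ 6 * (Matrix.of A).det := by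
    have := congrArg det hBA
    rw [det_mul, det_transpose, det_smul, Fintype.card_fin] at this
    rw [pow_two, this]
    ring
  rcases Int.isUnit_iff.1 (IsUnit.of_mul_eq_one_right _ hd1) with h | h
  · rw [hd2, h, mul_one]
  · rw [h] at hd2
    have : 0 < (l : ℤ) ^ 6 := by positivity
    nlinarith [sq_nonneg B.det]

/-! ### Primitive similitudes above a given isotropic vector -/

/-- The integral matrices `ℓ Q`, where `Q` is a rational orthogonal matrix of level `ℓ`. -/
def primitiveSimilitudes (l : ℕ) : Set (Matrix (Fin 3) (Fin 3) ℤ) :=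
  {G | Gᵀ * G = ((l : ℤ) ^ 2) • 1 ∧ ∀ p : ℕ, p.Prime → p ∣ l → ∃ i j, ¬ (p : ℤ) ∣ G i j}

theorem mul_transpose_of_transpose_mul {l : ℕ} (hl : 1 ≤ l) {G : Matrix (Fin 3) (Fin 3) ℤ}
    (hG : Gᵀ * G = ((l : ℤ) ^ 2) • 1) : G * Gᵀ = ((l : ℤ) ^ 2) • 1 := by
  have hl0 : (l : ℤ) ^ 2 ≠ 0 := pow_ne_zero 2 (by exact_mod_cast Nat.one_le_iff_ne_zero.1 hl)
  have hdet : (Gᵀ).det ≠ 0 := by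
    intro h
    have h1 := congrArg det hG
    rw [det_mul, h, zero_mul, det_smul, det_one, mul_one] at h1
    exact pow_ne_zero _ hl0 h1.symm
  have h2 : Gᵀ * (G * Gᵀ - ((l : ℤ) ^ 2) • 1) = 0 := by
    rw [Matrix.mul_sub, ← Matrix.mul_assoc, hG, Matrix.smul_mul, Matrix.mul_smul, Matrix.one_mul,
      Matrix.mul_one, sub_self]
  have h3 := congrArg ((Gᵀ).adjugate * ·) h2
  simp only [← Matrix.mul_assoc, adjugate_mul, Matrix.mul_zero, smul_mul, Matrix.one_mul] at h3
  exact sub_eq_zero.1 ((smul_eq_zero.1 h3).resolve_left hdet)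

/-- The unimodular lattice attached to an isotropic vector has an orthonormal basis. -/
theorem exists_mem_primitiveSimilitudes {l : ℕ} (hl : 1 ≤ l) (hodd : Odd l) {v : Fin 3 → ZMod l}
    (hv : v ∈ isotropicUnimodular (ZMod l)) :
    ∃ G ∈ primitiveSimilitudes l, ∃ w : Fin 3 → ZMod l,
      ∀ i j, (G i j : ZMod l) = v i * w j := by
  have hl0 : (0 : ℤ) < l := by exact_mod_cast hl
  obtain ⟨u, b, huv, hu, hb⟩ := exists_int_lift_isotropic hodd hv
  obtain ⟨B, hdet, hB⟩ := exists_basisMatrix_neighbourLattice hl u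
  have hdet2 := det_sq_of_basisMatrix_neighbourLattice hl hu hb hdet hB
  have hmem : ∀ z, B *ᵥ z ∈ neighbourLattice l u := fun z => (hB _).2 ⟨z, rfl⟩
  obtain ⟨z, w, hzz, hww, hzw⟩ := exists_orthogonal_pair B hl hdet2 fun z w =>
    sq_dvd_dotProduct_of_mem_neighbourLattice hu (hmem z) (hmem w)
  have hl3 : (l : ℤ) ^ 3 ∣ B.det := by
    rw [← Int.pow_dvd_pow_iff two_ne_zero, hdet2]
    exact ⟨1, by ring⟩
  -- The third basis vector is the cross product divided by `ℓ`. It lies in the lattice by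
  -- self-duality, since triple products of lattice vectors are multiples of `det B`, hence of `ℓ³`.
  obtain ⟨x, hx, hcross⟩ := exists_mem_neighbourLattice_of_dual hl hu hb hl0.ne'
    (d := (B *ᵥ z) ⨯₃ (B *ᵥ w)) (by
      intro y hy
      obtain ⟨t, rfl⟩ := (hB y).1 hy
      have h : ((B *ᵥ z) ⨯₃ (B *ᵥ w)) ⬝ᵥ (B *ᵥ t) = B.det * ((z ⨯₃ w) ⬝ᵥ t) := by
        simp only [cross_apply, mulVec, dotProduct, Fin.sum_univ_three, det_fin_three,
          cons_val_zero, cons_val_one, cons_val]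
        ring
      rw [h, show (l : ℤ) * (l : ℤ) ^ 2 = (l : ℤ) ^ 3 by ring]
      exact hl3.mul_right _)
  set y₁ := B *ᵥ z with hy₁
  set y₂ := B *ᵥ w with hy₂
  have h1x : y₁ ⬝ᵥ x = 0 := by
    have := dot_self_cross y₁ y₂
    rw [hcross, dotProduct_smul, smul_eq_mul] at this
    exact (mul_eq_zero.1 this).resolve_left hl0.ne'
  have h2x : y₂ ⬝ᵥ x = 0 := by
    have := dot_cross_self y₁ y₂
    rw [hcross, dotProduct_smul, smul_eq_mul] at this
    exact (mul_eq_zero.1 this).resolve_left hl0.ne'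
  have hxx : x ⬝ᵥ x = (l : ℤ) ^ 2 := by
    have := cross_dot_cross y₁ y₂ y₁ y₂
    rw [hcross, dotProduct_smul, smul_dotProduct, hzz, hww, dotProduct_comm y₂ y₁, hzw,
      smul_eq_mul, smul_eq_mul] at this
    apply mul_left_cancel₀ (pow_ne_zero 2 hl0.ne')
    linear_combination this
  let G : Matrix (Fin 3) (Fin 3) ℤ := (Matrix.of ![y₁, y₂, x])ᵀ
  have hGG : Gᵀ * G = ((l : ℤ) ^ 2) • 1 := by
    have key : ∀ i j, (Gᵀ * G) i j = (![y₁, y₂, x] i) ⬝ᵥ (![y₁, y₂, x] j) := fun i j => rfl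
    ext i j
    rw [key]
    fin_cases i <;> fin_cases j <;>
      simp [hzz, hww, hzw, h1x, h2x, hxx, dotProduct_comm x, dotProduct_comm y₂ y₁]
  have hcol : ∀ j, Gᵀ j ∈ neighbourLattice l u := by
    intro j
    fin_cases j
    · exact hmem z
    · exact hmem w
    · exact hx
  refine ⟨G, ⟨hGG, ?_⟩, ?_⟩
  · intro p hp hpl
    by_contra! hcon
    have hpz : Prime (p : ℤ) := Nat.prime_iff_prime_int.1 hp
    -- From `Gᵀ u = ℓ² a` follows `u = G a`, so a prime dividing all of `G` would divide `u`,
    -- contradicting `b ⬝ᵥ u ≡ 1`.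
    have hGv : ∀ j, ∃ a, (Gᵀ *ᵥ u) j = (l : ℤ) ^ 2 * a := fun j => (hcol j).2
    choose a ha using hGv
    have h1 : ((l : ℤ) ^ 2) • u = ((l : ℤ) ^ 2) • (G *ᵥ a) := by
      rw [← mulVec_smul, show ((l : ℤ) ^ 2) • a = Gᵀ *ᵥ u from (funext ha).symm, mulVec_mulVec,
        mul_transpose_of_transpose_mul hl hGG, smul_mulVec, one_mulVec]
    have h2 : u = G *ᵥ a := smul_right_injective _ (pow_ne_zero 2 hl0.ne') h1
    have h3 : (p : ℤ) ∣ b ⬝ᵥ u := by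
      refine Finset.dvd_sum fun i _ => Dvd.dvd.mul_left ?_ _
      rw [h2]
      change (p : ℤ) ∣ ∑ j, G i j * a j
      exact Finset.dvd_sum fun j _ => (hcon i j).mul_right _
    apply hpz.not_dvd_one
    have h4 := dvd_sub h3 ((Int.natCast_dvd_natCast.2 hpl).trans hb)
    rwa [sub_sub_cancel] at h4
  · choose c hc using fun j => (hcol j).1
    refine ⟨fun j => c j, fun i j => ?_⟩
    have := (ZMod.intCast_zmod_eq_zero_iff_dvd _ l).2 (hc j i)
    push_cast at this
    rw [sub_eq_zero, huv] at this
    rw [mul_comm]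
    exact this

/-! ### Rank-one reduction modulo `ℓ` -/

theorem exists_dotProduct_sub_one_dvd {l : ℕ} {y : Fin 3 → ℤ}
    (hy : ∀ p : ℕ, p.Prime → p ∣ l → ∃ i, ¬ (p : ℤ) ∣ y i) :
    ∃ b : Fin 3 → ℤ, (l : ℤ) ∣ b ⬝ᵥ y - 1 := by
  have hco : IsCoprime (((Int.gcd (Int.gcd (y 0) (y 1)) (y 2) : ℕ) : ℤ)) (l : ℤ) := by
    rw [Nat.isCoprime_iff_coprime]
    refine Nat.Coprime.symm (Nat.coprime_of_dvd fun p hp hpl hpg => ?_)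
    obtain ⟨i, hi⟩ := hy p hp hpl
    have h := Int.natCast_dvd_natCast.2 hpg
    rw [Int.dvd_coe_gcd_iff, Int.dvd_coe_gcd_iff] at h
    apply hi
    fin_cases i
    · exact h.1.1
    · exact h.1.2
    · exact h.2
  obtain ⟨r, s, hrs⟩ := hco
  have h1 := Int.gcd_eq_gcd_ab (y 0) (y 1)
  have h2 := Int.gcd_eq_gcd_ab (Int.gcd (y 0) (y 1)) (y 2)
  set g := Int.gcdA (Int.gcd (y 0) (y 1)) (y 2)
  refine ⟨![r * g * Int.gcdA (y 0) (y 1), r * g * Int.gcdB (y 0) (y 1),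
    r * Int.gcdB (Int.gcd (y 0) (y 1)) (y 2)], -s, ?_⟩
  simp only [dotProduct, Fin.sum_univ_three, cons_val_zero, cons_val_one, cons_val]
  linear_combination hrs - r * h2 - r * g * h1

/-- For each prime `p` dividing `ℓ` some column `j p` is nonzero mod `p`; the Chinese remainder
theorem gives `a` congruent mod `p` to the unit vector selecting that column. -/
theorem exists_mulVec_not_dvd {l : ℕ} (hl : 1 ≤ l) {G : Matrix (Fin 3) (Fin 3) ℤ}
    (hG : ∀ p : ℕ, p.Prime → p ∣ l → ∃ i j, ¬ (p : ℤ) ∣ G i j) :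
    ∃ a : Fin 3 → ℤ, ∀ p : ℕ, p.Prime → p ∣ l → ∃ i, ¬ (p : ℤ) ∣ (G *ᵥ a) i := by
  have h : ∀ p : ℕ, ∃ j, p.Prime → p ∣ l → ∃ i, ¬ (p : ℤ) ∣ G i j := by
    intro p
    by_cases hp : p.Prime ∧ p ∣ l
    · obtain ⟨i, j, hij⟩ := hG p hp.1 hp.2
      exact ⟨j, fun _ _ => ⟨i, hij⟩⟩
    · exact ⟨0, fun h1 h2 => absurd ⟨h1, h2⟩ hp⟩
  choose j hj using h
  have hcop : Set.Pairwise (l.primeFactors : Set ℕ) (Function.onFun Nat.Coprime id) :=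
    fun p hp q hq hpq => (Nat.coprime_primes (Nat.prime_of_mem_primeFactors hp)
      (Nat.prime_of_mem_primeFactors hq)).2 hpq
  have hcrt : ∀ k : Fin 3, ∃ c : ℕ, ∀ p ∈ l.primeFactors,
      c ≡ (if j p = k then 1 else 0) [MOD p] := fun k => by
    obtain ⟨c, hc⟩ := Nat.chineseRemainderOfFinset (fun p => if j p = k then 1 else 0) id
      l.primeFactors (fun p hp => (Nat.prime_of_mem_primeFactors hp).ne_zero) hcop
    exact ⟨c, hc⟩
  choose c hc using hcrt
  refine ⟨fun k => c k, fun p hp hpl => ?_⟩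
  obtain ⟨i, hi⟩ := hj p hp hpl
  refine ⟨i, fun hd => hi ?_⟩
  have hmem : p ∈ l.primeFactors := Nat.mem_primeFactors.2 ⟨hp, hpl, by omega⟩
  rw [← ZMod.intCast_zmod_eq_zero_iff_dvd] at hd ⊢
  have hcz : ∀ k, ((c k : ℤ) : ZMod p) = if j p = k then 1 else 0 := by
    intro k
    have := (ZMod.natCast_eq_natCast_iff _ _ _).2 (hc k p hmem)
    push_cast at this ⊢
    exact this
  rw [← hd]
  change _ = ((∑ k, G i k * (c k : ℤ) : ℤ) : ZMod p)
  rw [Int.cast_sum]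
  simp only [Int.cast_mul, hcz, mul_ite, mul_one, mul_zero, Finset.sum_ite_eq, Finset.mem_univ,
    if_true]

theorem mul_eq_mul_of_adjugate_eq_zero {R : Type*} [CommRing R] {A : Matrix (Fin 3) (Fin 3) R}
    (hA : A.adjugate = 0) (i j k m : Fin 3) : A i j * A k m = A i m * A k j := by
  rw [adjugate_fin_three] at hA
  have h00 := congrFun (congrFun hA 0) 0
  have h01 := congrFun (congrFun hA 0) 1
  have h02 := congrFun (congrFun hA 0) 2
  have h10 := congrFun (congrFun hA 1) 0
  have h11 := congrFun (congrFun hA 1) 1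
  have h12 := congrFun (congrFun hA 1) 2
  have h20 := congrFun (congrFun hA 2) 0
  have h21 := congrFun (congrFun hA 2) 1
  have h22 := congrFun (congrFun hA 2) 2
  simp only [of_apply, cons_val', cons_val_zero, cons_val_one, cons_val, cons_val_fin_one,
    Matrix.zero_apply] at h00 h01 h02 h10 h11 h12 h20 h21 h22
  clear hA
  fin_cases i <;> fin_cases k <;> try rfl
  all_goals
    fin_cases j <;> fin_cases m <;> dsimp only [Fin.zero_eta, Fin.mk_one, Fin.reduceFinMk] <;>
    try first
    | rfl
    | exact mul_comm _ _
    | grind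

/-- Here `det G = ε ℓ³`, and multiplying `Gᵀ * G = ℓ² • 1` by the adjugate gives `adj G = ε ℓ Gᵀ`.
-/
theorem adjugate_map_eq_zero {l : ℕ} (hl : 1 ≤ l) {G : Matrix (Fin 3) (Fin 3) ℤ}
    (hG : Gᵀ * G = ((l : ℤ) ^ 2) • 1) : (G.map (Int.cast : ℤ → ZMod l)).adjugate = 0 := by
  have hl0 : (l : ℤ) ≠ 0 := by exact_mod_cast Nat.one_le_iff_ne_zero.1 hl
  have hdet : G.det ^ 2 = (l : ℤ) ^ 6 := by
    have h := congrArg det hG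
    rw [det_mul, det_transpose, det_smul, det_one, mul_one, Fintype.card_fin] at h
    linear_combination h
  obtain ⟨ε, hε⟩ : (l : ℤ) ^ 3 ∣ G.det := by
    rw [← Int.pow_dvd_pow_iff two_ne_zero, hdet]
    exact ⟨1, by ring⟩
  have hadj : ∀ i j, G.adjugate i j = l * (ε * G j i) := by
    intro i j
    have h := congrArg (· * G.adjugate) hG
    simp only [Matrix.mul_assoc, mul_adjugate, Matrix.mul_smul, Matrix.mul_one, smul_mul,
      Matrix.one_mul] at h
    have h' := congrFun (congrFun h i) j
    simp only [Matrix.smul_apply, transpose_apply, smul_eq_mul, hε] at h'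
    apply mul_left_cancel₀ (pow_ne_zero 2 hl0)
    linear_combination -h'
  have h := (Int.castRingHom (ZMod l)).map_adjugate G
  change G.adjugate.map _ = (G.map _).adjugate at h
  rw [show G.map (Int.cast : ℤ → ZMod l) = G.map (Int.castRingHom (ZMod l)) from rfl, ← h]
  ext i j
  rw [map_apply, hadj]
  simp

theorem exists_eq_mul_of_mem_primitiveSimilitudes {l : ℕ} (hl : 1 ≤ l)
    {G : Matrix (Fin 3) (Fin 3) ℤ} (hG : G ∈ primitiveSimilitudes l) :
    ∃ v ∈ isotropicUnimodular (ZMod l), ∃ w c : Fin 3 → ZMod l, c ⬝ᵥ w = 1 ∧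
      ∀ i j, (G i j : ZMod l) = v i * w j := by
  obtain ⟨a, ha⟩ := exists_mulVec_not_dvd hl hG.2
  obtain ⟨b, hb⟩ := exists_dotProduct_sub_one_dvd ha
  have hminor : ∀ i j k m, (G i j : ZMod l) * G k m = G i m * G k j :=
    mul_eq_mul_of_adjugate_eq_zero (adjugate_map_eq_zero hl hG.1)
  have hbv : ∑ k, (b k : ZMod l) * ∑ m, (G k m : ZMod l) * a m = 1 := by
    have h := (ZMod.intCast_zmod_eq_zero_iff_dvd _ l).2 hb
    rw [Int.cast_sub, sub_eq_zero] at h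
    simpa [dotProduct, mulVec, Fin.sum_univ_three] using h
  -- With `bᵀ G a = 1`, the vanishing minors give `G = (G a)(bᵀ G)`.
  set v : Fin 3 → ZMod l := fun i => ∑ m, (G i m : ZMod l) * a m with hv
  set w : Fin 3 → ZMod l := fun j => ∑ k, (b k : ZMod l) * G k j with hw
  have hGvw : ∀ i j, (G i j : ZMod l) = v i * w j := by
    intro i j
    calc (G i j : ZMod l) = ∑ k, ∑ m, (b k : ZMod l) * a m * (G i j * G k m) := by
          conv_lhs => rw [← mul_one (G i j : ZMod l), ← hbv]
          simp only [Fin.sum_univ_three]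
          ring
      _ = ∑ k, ∑ m, (b k : ZMod l) * a m * (G i m * G k j) := by simp only [hminor i j]
      _ = v i * w j := by
          simp only [hv, hw, Fin.sum_univ_three]
          ring
  have hcw : (fun m => (a m : ZMod l)) ⬝ᵥ w = 1 := by
    rw [← hbv]
    simp only [hw, dotProduct, Fin.sum_univ_three]
    ring
  refine ⟨v, ⟨?_, _, hbv⟩, w, _, hcw, hGvw⟩
  -- These are the entries of `Gᵀ * G` mod `ℓ`; contracting twice with `a`, where `a ⬝ᵥ w = 1`,
  -- isolates `v ⬝ᵥ v`.
  have hww : ∀ i j, w i * w j * (v ⬝ᵥ v) = 0 := by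
    intro i j
    have h := congrFun (congrFun hG.1 i) j
    rw [Matrix.smul_apply, smul_eq_mul, Matrix.mul_apply] at h
    have h' := congrArg (Int.cast : ℤ → ZMod l) h
    simp only [transpose_apply, Int.cast_sum, Int.cast_mul, hGvw, Int.cast_pow, Int.cast_natCast,
      ZMod.natCast_self] at h'
    rw [zero_pow two_ne_zero, zero_mul] at h'
    rw [← h']
    simp only [dotProduct, Fin.sum_univ_three]
    ring
  calc v ⬝ᵥ v = ((fun m => (a m : ZMod l)) ⬝ᵥ w) * ((fun m => (a m : ZMod l)) ⬝ᵥ w) *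
        (v ⬝ᵥ v) := by rw [hcw]; ring
    _ = ∑ i, ∑ j, (a i : ZMod l) * a j * (w i * w j * (v ⬝ᵥ v)) := by
        generalize v ⬝ᵥ v = s
        simp only [dotProduct, Fin.sum_univ_three]
        ring
    _ = 0 := by simp [hww]

theorem ncard_isotropicUnimodular_of_mem_primitiveSimilitudes {l : ℕ} (hl : 1 ≤ l)
    {G : Matrix (Fin 3) (Fin 3) ℤ} (hG : G ∈ primitiveSimilitudes l) :
    {v | v ∈ isotropicUnimodular (ZMod l) ∧
      ∃ w : Fin 3 → ZMod l, ∀ i j, (G i j : ZMod l) = v i * w j}.ncard = Nat.totient l := by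
  have : NeZero l := ⟨by omega⟩
  obtain ⟨v, ⟨hv0, b, hb⟩, w, c, hcw, hGvw⟩ := exists_eq_mul_of_mem_primitiveSimilitudes hl hG
  have himage : {v | v ∈ isotropicUnimodular (ZMod l) ∧
      ∃ w : Fin 3 → ZMod l, ∀ i j, (G i j : ZMod l) = v i * w j} =
      Set.range fun u : (ZMod l)ˣ => (u : ZMod l) • v := by
    ext x
    constructor
    · rintro ⟨⟨-, d, hd⟩, y, hy⟩
      have h1 : ∀ i, v i = (c ⬝ᵥ y) * x i := by
        intro i
        calc v i = v i * (c ⬝ᵥ w) := by rw [hcw, mul_one]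
          _ = ∑ j, c j * (v i * w j) := by
            simp only [dotProduct, Fin.sum_univ_three]; ring
          _ = ∑ j, c j * (x i * y j) := by simp only [← hGvw, hy]
          _ = (c ⬝ᵥ y) * x i := by
            simp only [dotProduct, Fin.sum_univ_three]; ring
      have h2 : (b ⬝ᵥ x) * (c ⬝ᵥ y) = 1 := by
        rw [← hb, show v = (c ⬝ᵥ y) • x from funext h1, dotProduct_smul, smul_eq_mul, mul_comm]
      refine ⟨⟨b ⬝ᵥ x, c ⬝ᵥ y, h2, by rw [mul_comm, h2]⟩, ?_⟩
      ext i
      simp only [Pi.smul_apply, smul_eq_mul, h1 i]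
      rw [← mul_assoc, h2, one_mul]
    · rintro ⟨u, rfl⟩
      refine ⟨⟨by simp [smul_dotProduct, dotProduct_smul, hv0], (↑u⁻¹ : ZMod l) • b, ?_⟩,
        (↑u⁻¹ : ZMod l) • w, fun i j => ?_⟩
      · simp [smul_dotProduct, dotProduct_smul, hb]
      · rw [hGvw]
        simp only [Pi.smul_apply, smul_eq_mul]
        rw [mul_mul_mul_comm, Units.mul_inv, one_mul]
  rw [himage, ← Set.image_univ, Set.ncard_image_of_injective, Set.ncard_univ,
    Nat.card_eq_fintype_card, ZMod.card_units_eq_totient]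
  intro u u' h
  have h' := congrArg (b ⬝ᵥ ·) h
  simp only [dotProduct_smul, hb, smul_eq_mul, mul_one] at h'
  exact Units.ext h'

/-! ### The 48 similitudes over one isotropic vector -/

/-- The six integral vectors of norm one in dimension three. -/
def signedUnitVector : Fin 6 → Fin 3 → ℤ :=
  ![![1, 0, 0], ![-1, 0, 0], ![0, 1, 0], ![0, -1, 0], ![0, 0, 1], ![0, 0, -1]]

theorem exists_signedUnitVector_eq {x : Fin 3 → ℤ} (hx : x ⬝ᵥ x = 1) :
    ∃ k, signedUnitVector k = x := by
  rw [dotProduct, Fin.sum_univ_three] at hx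
  have hb : ∀ i, -1 ≤ x i ∧ x i ≤ 1 := by
    intro i
    have : x i * x i ≤ 1 := by
      have h0 := mul_self_nonneg (x 0)
      have h1 := mul_self_nonneg (x 1)
      have h2 := mul_self_nonneg (x 2)
      fin_cases i <;> simp <;> linarith
    constructor <;> nlinarith
  have hxe : x = ![x 0, x 1, x 2] := by ext i; fin_cases i <;> rfl
  obtain ⟨h0, h0'⟩ := hb 0
  obtain ⟨h1, h1'⟩ := hb 1
  obtain ⟨h2, h2'⟩ := hb 2
  rw [hxe]
  generalize x 0 = a at *
  generalize x 1 = b at *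
  generalize x 2 = c at *
  clear hxe hb
  interval_cases a <;> interval_cases b <;> interval_cases c <;> first
    | (exfalso; revert hx; decide)
    | decide

theorem ncard_int_orthogonal : {U : Matrix (Fin 3) (Fin 3) ℤ | Uᵀ * U = 1}.ncard = 48 := by
  have h : {U : Matrix (Fin 3) (Fin 3) ℤ | Uᵀ * U = 1} =
      (fun (f : Fin 3 → Fin 6) => Matrix.of fun i => signedUnitVector (f i)) ''
        (Finset.univ.filter fun f : Fin 3 → Fin 6 => ∀ i j,
          signedUnitVector (f i) ⬝ᵥ signedUnitVector (f j) = if i = j then 1 else 0) := by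
    ext U
    rw [Set.mem_ofPred_eq, mul_eq_one_comm]
    constructor
    · intro hU
      have hrow : ∀ i j, U i ⬝ᵥ U j = if i = j then 1 else 0 := fun i j =>
        (congrFun (congrFun hU i) j).trans (Matrix.one_apply)
      choose f hf using fun i => exists_signedUnitVector_eq ((hrow i i).trans (if_pos rfl))
      refine ⟨f, ?_, ?_⟩
      · simp only [Finset.coe_filter, Finset.mem_univ, true_and, Set.mem_ofPred_eq, hf]
        exact hrow
      · ext i j
        simp [hf]
    · rintro ⟨f, hf, rfl⟩
      simp only [Finset.coe_filter, Finset.mem_univ, true_and, Set.mem_ofPred_eq] at hf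
      ext i j
      exact (hf i j).trans (Matrix.one_apply).symm
  have hinj : Function.Injective signedUnitVector := by decide
  rw [h, Set.ncard_image_of_injective, Set.ncard_coe_finset]
  · decide +kernel
  · intro f g hfg
    ext1 i
    exact hinj (congrFun hfg i)

/-- Write `G i j = c j * u i + ℓ * s i j` and `t j = ∑ i, s i j * u i`; the point is that `ℓ ∣ t j`.
The relation `Gᵀ * G = ℓ² • 1` gives `c i * t j + c j * t i ≡ 0`. As `c` is unimodular mod `ℓ`,
contracting twice gives `2 (e ⬝ᵥ t) ≡ 0`, and oddness of `ℓ` finishes. -/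
theorem transpose_mem_neighbourLattice {l : ℕ} (hodd : Odd l) {u : Fin 3 → ℤ}
    (hu : (l : ℤ) ^ 2 ∣ u ⬝ᵥ u) {G : Matrix (Fin 3) (Fin 3) ℤ}
    (hG : G ∈ primitiveSimilitudes l) {w : Fin 3 → ZMod l}
    (hw : ∀ i j, (G i j : ZMod l) = u i * w j) (j : Fin 3) :
    Gᵀ j ∈ neighbourLattice l u := by
  have hl0 : (l : ℤ) ≠ 0 := by
    obtain ⟨m, hm⟩ := hodd
    omega
  choose c hc using fun j => ZMod.intCast_surjective (w j)
  have hd : ∀ i j, (l : ℤ) ∣ G i j - c j * u i := by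
    intro i j
    rw [← ZMod.intCast_zmod_eq_zero_iff_dvd]
    push_cast
    rw [hw, hc, mul_comm, sub_self]
  choose s hs using hd
  refine ⟨⟨c j, fun i => ⟨s i j, hs i j⟩⟩, ?_⟩
  set t : Fin 3 → ℤ := fun j => ∑ i, s i j * u i with ht
  have hcol : ∀ j, Gᵀ j ⬝ᵥ u = c j * (u ⬝ᵥ u) + l * t j := by
    intro j
    have e : ∀ i, G i j = c j * u i + l * s i j := fun i => by linear_combination hs i j
    simp only [dotProduct, transpose_apply, e, ht, Fin.sum_univ_three]
    ring
  obtain ⟨e, he⟩ : ∃ e : Fin 3 → ℤ, (l : ℤ) ∣ e ⬝ᵥ c - 1 := by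
    apply exists_dotProduct_sub_one_dvd
    intro p hp hpl
    by_contra! hcon
    obtain ⟨i, j, hij⟩ := hG.2 p hp hpl
    apply hij
    rw [show G i j = c j * u i + l * s i j by linear_combination hs i j]
    exact dvd_add ((hcon j).mul_right _) ((Int.natCast_dvd_natCast.2 hpl).mul_right _)
  have hct : ∀ i j, (l : ℤ) ∣ c i * t j + c j * t i := by
    intro i j
    have h1 : (l : ℤ) ^ 2 ∣ (Gᵀ * G) i j := by
      rw [hG.1]
      exact dvd_mul_right _ _
    have h2 : (Gᵀ * G) i j = l * (c i * t j + c j * t i) + c i * c j * (u ⬝ᵥ u) +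
        (l : ℤ) ^ 2 * ∑ k, s k i * s k j := by
      have e : ∀ i j, G i j = c j * u i + l * s i j := fun i j => by linear_combination hs i j
      simp only [Matrix.mul_apply, transpose_apply, e, ht, Fin.sum_univ_three, dotProduct]
      ring
    rw [h2] at h1
    have h3 := (dvd_add_left (hu.mul_left (c i * c j))).1
      ((dvd_add_left (dvd_mul_right _ _)).1 h1)
    rw [pow_two] at h3
    exact (mul_dvd_mul_iff_left hl0).1 h3
  have htj : (l : ℤ) ∣ t j := by
    obtain ⟨m, hm⟩ := hodd
    have hm' : (l : ℤ) = 2 * m + 1 := by exact_mod_cast hm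
    have hsum : ∀ j, (l : ℤ) ∣ t j + c j * (e ⬝ᵥ t) := by
      intro j
      have h1 : (l : ℤ) ∣ ∑ i, e i * (c i * t j + c j * t i) :=
        Finset.dvd_sum fun i _ => (hct i j).mul_left _
      have h2 := dvd_sub h1 (he.mul_left (t j))
      refine Eq.mp (congrArg ((l : ℤ) ∣ ·) ?_) h2
      simp only [dotProduct, Fin.sum_univ_three]
      ring
    have hτ : (l : ℤ) ∣ e ⬝ᵥ t := by
      have h1 : (l : ℤ) ∣ ∑ j, e j * (t j + c j * (e ⬝ᵥ t)) :=
        Finset.dvd_sum fun j _ => (hsum j).mul_left _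
      have h2 : (l : ℤ) ∣ 2 * (e ⬝ᵥ t) := by
        have h3 := dvd_sub h1 (he.mul_left (e ⬝ᵥ t))
        refine Eq.mp (congrArg ((l : ℤ) ∣ ·) ?_) h3
        simp only [dotProduct, Fin.sum_univ_three]
        ring
      have h4 := dvd_sub (dvd_mul_right (l : ℤ) (e ⬝ᵥ t)) (h2.mul_left m)
      refine Eq.mp (congrArg ((l : ℤ) ∣ ·) ?_) h4
      rw [hm']
      ring
    exact (dvd_add_left (hτ.mul_left (c j))).1 (hsum j)
  rw [hcol, pow_two]
  exact dvd_add (by rw [← pow_two]; exact hu.mul_left _) (mul_dvd_mul_left _ htj)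

theorem ncard_primitiveSimilitudes_of_mem_isotropicUnimodular {l : ℕ} (hl : 1 ≤ l) (hodd : Odd l)
    {v : Fin 3 → ZMod l} (hv : v ∈ isotropicUnimodular (ZMod l)) :
    {G | G ∈ primitiveSimilitudes l ∧
      ∃ w : Fin 3 → ZMod l, ∀ i j, (G i j : ZMod l) = v i * w j}.ncard = 48 := by
  have hl0 : (l : ℤ) ^ 2 ≠ 0 := pow_ne_zero 2 (by exact_mod_cast Nat.one_le_iff_ne_zero.1 hl)
  obtain ⟨G₀, hG₀, w₀, hw₀⟩ := exists_mem_primitiveSimilitudes hl hodd hv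
  obtain ⟨u, b, huv, hu, hb⟩ := exists_int_lift_isotropic hodd hv
  have himage : {G | G ∈ primitiveSimilitudes l ∧
      ∃ w : Fin 3 → ZMod l, ∀ i j, (G i j : ZMod l) = v i * w j} =
      (fun U => G₀ * U) '' {U : Matrix (Fin 3) (Fin 3) ℤ | Uᵀ * U = 1} := by
    ext G
    constructor
    · rintro ⟨hG, w, hw⟩
      -- Both sets of columns lie in the same lattice, so `U = ℓ⁻² G₀ᵀ G` is integral; it is then
      -- orthogonal.
      have hdvd : ∀ i j, (l : ℤ) ^ 2 ∣ (G₀ᵀ * G) i j := fun i j =>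
        sq_dvd_dotProduct_of_mem_neighbourLattice hu
          (transpose_mem_neighbourLattice hodd hu hG₀ (by simpa only [huv] using hw₀) i)
          (transpose_mem_neighbourLattice hodd hu hG (by simpa only [huv] using hw) j)
      choose U hU using hdvd
      have hU' : G₀ᵀ * G = ((l : ℤ) ^ 2) • (Matrix.of U) := by
        ext i j
        exact hU i j
      have h1 : G₀ * Matrix.of U = G := by
        have h := congrArg (G₀ * ·) hU'
        simp only [← Matrix.mul_assoc, mul_transpose_of_transpose_mul hl hG₀.1, Matrix.mul_smul,
          smul_mul, Matrix.one_mul] at h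
        exact (smul_right_injective _ hl0 h).symm
      refine ⟨Matrix.of U, ?_, h1⟩
      have h2 := hG.1
      rw [← h1, transpose_mul, Matrix.mul_assoc, ← Matrix.mul_assoc G₀ᵀ, hG₀.1, smul_mul,
        Matrix.one_mul, Matrix.mul_smul] at h2
      exact smul_right_injective _ hl0 h2
    · rintro ⟨U, hU, rfl⟩
      have hU1 : U * Uᵀ = 1 := mul_eq_one_comm.1 hU
      refine ⟨⟨?_, fun p hp hpl => ?_⟩, fun j => ∑ k, w₀ k * U k j, fun i j => ?_⟩
      · rw [transpose_mul, Matrix.mul_assoc, ← Matrix.mul_assoc G₀ᵀ, hG₀.1, smul_mul,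
          Matrix.one_mul, Matrix.mul_smul, hU]
      · by_contra! hcon
        obtain ⟨i, j, hij⟩ := hG₀.2 p hp hpl
        apply hij
        have : G₀ = (G₀ * U) * Uᵀ := by rw [Matrix.mul_assoc, hU1, Matrix.mul_one]
        rw [this, Matrix.mul_apply]
        exact Finset.dvd_sum fun k _ => (hcon i k).mul_right _
      · simp only [Matrix.mul_apply, Int.cast_sum, Int.cast_mul, hw₀, Finset.mul_sum, mul_assoc]
  rw [himage, Set.ncard_image_of_injective, ncard_int_orthogonal]
  intro U U' h
  have h' := congrArg (G₀ᵀ * ·) h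
  simp only [← Matrix.mul_assoc, hG₀.1, smul_mul, Matrix.one_mul] at h'
  exact smul_right_injective _ hl0 h'

/-! ### The double count -/

theorem finite_primitiveSimilitudes {l : ℕ} (hl : 1 ≤ l) (hodd : Odd l) :
    (primitiveSimilitudes l).Finite := by
  have : NeZero l := ⟨by omega⟩
  have hsub : primitiveSimilitudes l ⊆ ⋃ v ∈ isotropicUnimodular (ZMod l),
      {G | G ∈ primitiveSimilitudes l ∧
        ∃ w : Fin 3 → ZMod l, ∀ i j, (G i j : ZMod l) = v i * w j} := by
    intro G hG
    obtain ⟨v, hv, w, -, -, hw⟩ := exists_eq_mul_of_mem_primitiveSimilitudes hl hG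
    exact Set.mem_biUnion hv ⟨hG, w, hw⟩
  refine Set.Finite.subset (Set.Finite.biUnion (Set.toFinite _) fun v hv => ?_) hsub
  apply Set.finite_of_ncard_ne_zero
  rw [ncard_primitiveSimilitudes_of_mem_isotropicUnimodular hl hodd hv]
  norm_num

theorem ncard_primitiveSimilitudes {l : ℕ} (hl : 1 ≤ l) (hodd : Odd l) :
    ((primitiveSimilitudes l).ncard : ℚ) =
      48 * (l : ℚ) * ∏ p ∈ l.primeFactors, (1 + 1 / (p : ℚ)) := by
  classical
  have : NeZero l := ⟨by omega⟩
  have hfin := finite_primitiveSimilitudes hl hodd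
  have hX := Set.toFinite (isotropicUnimodular (ZMod l))
  have hcount := Finset.card_mul_eq_card_mul (s := hfin.toFinset) (t := hX.toFinset)
    (fun (G : Matrix (Fin 3) (Fin 3) ℤ) (v : Fin 3 → ZMod l) =>
      ∃ w : Fin 3 → ZMod l, ∀ i j, (G i j : ZMod l) = v i * w j) (m := Nat.totient l) (n := 48)
    (by
      intro G hG
      rw [← ncard_isotropicUnimodular_of_mem_primitiveSimilitudes hl (hfin.mem_toFinset.1 hG),
        ← Set.ncard_coe_finset]
      congr 1
      ext v
      simp)
    (by
      intro v hv
      rw [← ncard_primitiveSimilitudes_of_mem_isotropicUnimodular hl hodd (hX.mem_toFinset.1 hv),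
        ← Set.ncard_coe_finset]
      congr 1
      ext G
      simp)
  rw [← Set.ncard_eq_toFinset_card _ hfin, ← Set.ncard_eq_toFinset_card _ hX,
    ← Nat.card_coe_set_eq (isotropicUnimodular (ZMod l))] at hcount
  have hcountq := congrArg (Nat.cast : ℕ → ℚ) hcount
  rw [Nat.cast_mul, Nat.cast_mul, card_isotropicUnimodular_zmod l hodd] at hcountq
  have htot : (Nat.totient l : ℚ) ≠ 0 := by
    exact_mod_cast (Nat.totient_pos.2 hl).ne'
  apply mul_right_cancel₀ htot
  rw [hcountq]
  push_cast
  ring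

/-! ### Parity of the level and passage to rational matrices -/

theorem odd_of_primitiveSimilitudes_nonempty {l : ℕ} (h : (primitiveSimilitudes l).Nonempty) :
    Odd l := by
  by_contra hodd
  rw [Nat.not_odd_iff_even] at hodd
  obtain ⟨G, hG, hprim⟩ := h
  obtain ⟨i, j, hij⟩ := hprim 2 Nat.prime_two hodd.two_dvd
  have hcol := congrFun (congrFun hG j) j
  simp only [Matrix.mul_apply, transpose_apply, Fin.sum_univ_three, Matrix.smul_apply,
    Matrix.one_apply_eq, smul_eq_mul, mul_one] at hcol
  obtain ⟨m, rfl⟩ := hodd.two_dvd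
  have h4 : ∀ x : ℤ, x * x % 4 = (x % 2) := by
    intro x
    rcases Int.even_or_odd' x with ⟨k, rfl | rfl⟩
    · rw [show 2 * k * (2 * k) = 4 * (k * k) by ring]; omega
    · rw [show (2 * k + 1) * (2 * k + 1) = 4 * (k * k + k) + 1 by ring]; omega
  have h0 := h4 (G 0 j)
  have h1 := h4 (G 1 j)
  have h2 := h4 (G 2 j)
  have h3 : ((2 * m : ℕ) : ℤ) ^ 2 = 4 * (m : ℤ) ^ 2 := by push_cast; ring
  rw [h3] at hcol
  apply hij
  rw [Nat.cast_ofNat]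
  fin_cases i <;> simp only [Fin.zero_eta, Fin.mk_one, Fin.reduceFinMk] <;> omega

theorem rationalOrthogonalOfLevel_three_eq_image {l : ℕ} (hl : 1 ≤ l) :
    rationalOrthogonalOfLevel 3 l =
      (fun G : Matrix (Fin 3) (Fin 3) ℤ => (l : ℚ)⁻¹ • G.map (Int.cast : ℤ → ℚ)) ''
        primitiveSimilitudes l := by
  have hl0 : (l : ℚ) ≠ 0 := by exact_mod_cast Nat.one_le_iff_ne_zero.1 hl
  have hmap : ∀ G : Matrix (Fin 3) (Fin 3) ℤ,
      (Gᵀ * G).map (Int.cast : ℤ → ℚ) = (G.map Int.cast)ᵀ * G.map Int.cast := by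
    intro G
    ext i j
    simp [Matrix.mul_apply]
  have hone : (((l : ℤ) ^ 2) • (1 : Matrix (Fin 3) (Fin 3) ℤ)).map (Int.cast : ℤ → ℚ) =
      ((l : ℚ) ^ 2) • 1 := by
    ext i j
    simp only [map_apply, Matrix.smul_apply, Matrix.one_apply, smul_eq_mul]
    split_ifs <;> simp
  have hinj : Function.Injective fun G : Matrix (Fin 3) (Fin 3) ℤ => G.map (Int.cast : ℤ → ℚ) :=
    map_injective Int.cast_injective
  ext Q
  constructor
  · rintro ⟨hQ, ⟨-, G, hG⟩, hleast⟩
    rw [mem_orthogonalGroup_iff'] at hQ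
    have hQG : Q = (l : ℚ)⁻¹ • G.map (Int.cast : ℤ → ℚ) := by
      rw [← hG, smul_smul, inv_mul_cancel₀ hl0, one_smul]
    refine ⟨G, ⟨hinj ?_, fun p hp hpl => ?_⟩, hQG.symm⟩
    · change (Gᵀ * G).map _ = Matrix.map _ _
      rw [hmap, hone, ← hG, transpose_smul, smul_mul, Matrix.mul_smul, smul_smul, ← pow_two]
      congr 1
    · by_contra! hcon
      choose H hH using hcon
      obtain ⟨m, rfl⟩ := hpl
      have hp0 : (p : ℚ) ≠ 0 := by exact_mod_cast hp.ne_zero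
      have hm : 1 ≤ m := Nat.pos_of_ne_zero (by rintro rfl; simp at hl)
      have := hleast ⟨hm, Matrix.of H, by
        ext i j
        have h1 := congrFun (congrFun hG i) j
        simp only [Matrix.smul_apply, map_apply, smul_eq_mul, hH, of_apply] at h1 ⊢
        push_cast at h1
        apply mul_left_cancel₀ hp0
        rw [← h1]
        ring⟩
      have := hp.two_le
      nlinarith
  · rintro ⟨G, ⟨hG, hprim⟩, rfl⟩
    refine ⟨?_, ⟨hl, G, ?_⟩, ?_⟩
    · rw [mem_orthogonalGroup_iff']
      change ((l : ℚ)⁻¹ • G.map (Int.cast : ℤ → ℚ))ᵀ * _ = 1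
      rw [transpose_smul, smul_mul, Matrix.mul_smul, ← hmap, hG, hone, smul_smul, smul_smul]
      rw [show (l : ℚ)⁻¹ * (l : ℚ)⁻¹ * (l : ℚ) ^ 2 = 1 by field_simp, one_smul]
    · rw [smul_smul, mul_inv_cancel₀ hl0, one_smul]
    · rintro m ⟨hm, H, hH⟩
      have hGH : ∀ i j, (m : ℤ) * G i j = l * H i j := by
        intro i j
        have h1 := congrFun (congrFun hH i) j
        simp only [Matrix.smul_apply, map_apply, smul_eq_mul] at h1
        field_simp at h1
        exact_mod_cast h1
      -- The level divides every admissible `m`: a prime dividing `ℓ / gcd(m, ℓ)` would divide every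
      -- entry of `G`.
      refine Nat.le_of_dvd hm ?_
      have hg : 0 < Nat.gcd m l := Nat.gcd_pos_of_pos_left _ hm
      obtain ⟨m', hm'⟩ := Nat.gcd_dvd_left m l
      obtain ⟨l', hl'⟩ := Nat.gcd_dvd_right m l
      have hco : Nat.Coprime m' l' := by
        have := Nat.coprime_div_gcd_div_gcd hg
        rwa [Nat.div_eq_of_eq_mul_right hg hm', Nat.div_eq_of_eq_mul_right hg hl'] at this
      by_contra hnd
      have hl1 : l' ≠ 1 := by
        rintro rfl
        rw [mul_one] at hl'
        exact hnd (hl' ▸ Nat.gcd_dvd_left m l)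
      obtain ⟨p, hp, hpl⟩ := Nat.exists_prime_and_dvd hl1
      obtain ⟨i, j, hij⟩ := hprim p hp (hl' ▸ hpl.mul_left _)
      have h1 : (m' : ℤ) * G i j = l' * H i j := by
        have h2 := hGH i j
        have h3 : ((Nat.gcd m l : ℕ) : ℤ) ≠ 0 := by exact_mod_cast hg.ne'
        apply mul_left_cancel₀ h3
        have e1 : (m : ℤ) = (Nat.gcd m l : ℕ) * m' := by exact_mod_cast hm'
        have e2 : (l : ℤ) = (Nat.gcd m l : ℕ) * l' := by exact_mod_cast hl'
        linear_combination h2 - G i j * e1 + H i j * e2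
      have h4 : (p : ℤ) ∣ m' * G i j := by
        rw [h1]
        exact (Int.natCast_dvd_natCast.2 hpl).mul_right _
      rcases (Nat.prime_iff_prime_int.1 hp).dvd_or_dvd h4 with h5 | h5
      · exact Nat.not_coprime_of_dvd_of_dvd hp.one_lt (Int.natCast_dvd_natCast.1 h5) hpl hco
      · exact hij h5

theorem mainTheorem7 (ℓ : ℕ) (hℓ : 1 ≤ ℓ) :
    ((rationalOrthogonalOfLevel 3 ℓ).Nonempty ↔ Odd ℓ) ∧
      (Odd ℓ →
        (rationalOrthogonalOfLevel 3 ℓ).Finite ∧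
          ((rationalOrthogonalOfLevel 3 ℓ).ncard : ℚ) =
            48 * (ℓ : ℚ) * ∏ p ∈ ℓ.primeFactors, (1 + 1 / (p : ℚ))) := by
  have hinj : Function.Injective fun G : Matrix (Fin 3) (Fin 3) ℤ =>
      (ℓ : ℚ)⁻¹ • G.map (Int.cast : ℤ → ℚ) := by
    have hl0 : (ℓ : ℚ)⁻¹ ≠ 0 := inv_ne_zero (by exact_mod_cast Nat.one_le_iff_ne_zero.1 hℓ)
    exact (smul_right_injective _ hl0).comp (map_injective Int.cast_injective)
  rw [rationalOrthogonalOfLevel_three_eq_image hℓ, Set.image_nonempty,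
    Set.ncard_image_of_injective _ hinj]
  refine ⟨⟨odd_of_primitiveSimilitudes_nonempty, fun hodd => ?_⟩, fun hodd =>
    ⟨(finite_primitiveSimilitudes hℓ hodd).image _, ncard_primitiveSimilitudes hℓ hodd⟩⟩
  apply Set.nonempty_of_ncard_ne_zero
  have hpos : (0 : ℚ) < ((primitiveSimilitudes ℓ).ncard : ℚ) := by
    rw [ncard_primitiveSimilitudes hℓ hodd]
    have hl0 : (0 : ℚ) < ℓ := by exact_mod_cast hℓ
    exact mul_pos (by positivity) (Finset.prod_pos fun p _ => by positivity)
  exact_mod_cast hpos.ne'
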